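/- **Setting.** Let $\Gamma=\mathbb Z^D$ with its graph distance, and attach to each site $x$ a finite-dimensional Hilbert space $\mathcal H_x$; for finite $\Lambda\subset\Gamma$ put $\mathcal H_\Lambda=\bigotimes_{x\in\Lambda}\mathcal H_x$ and $\mathcal A_\Lambda=\mathcal B(\mathcal H_\Lambda)$. A *Lindbladian* is a map $\mathcal L(\rho)=-i[H,\rho]+\sum_j\big(L_j\rho L_j^\dagger-\tfrac12\{L_j^\dagger L_j,\rho\}\big)$ with $H$ Hermitian and finitely many $L_j$. A superoperator $T$ of $\mathcal A_Z$ is regarded as the superoperator $T\otimes\mathrm{id}$ of $\mathcal A_\Lambda$ for $\Lambda\supset Z$. Write $\|\cdot\|_1$ for the trace norm and $\|T\|_\diamond=\sup_n\|T\otimes \mathrm{id}_n\|_{1\to1}$. Write $b_x(r)$ for the closed ball, $A(s)=\{y:\operatorname{dist}(y,A)\le s\}$ and $\partial_d\Lambda=\{x\in\Lambda:\operatorname{dist}(x,\Gamma\setminus\Lambda)\le d\}$. A *uniform family* $\mathcal L=(\mathcal M,\mathcal B)$ consists of a Lindbladian $\mathcal M_Z$ of $\mathcal A_Z$ for each finite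 $Z\subset\Gamma$, and, for each finite $\Lambda\subset\Gamma$, of a boundary condition: a convergent series $\mathcal B^{\partial\Lambda}=\sum_{d\ge1}\mathcal B^{\partial\Lambda}_d$, with $\mathcal B_d^{\partial\Lambda}$ supported on $\partial_d\Lambda$, such that $\mathcal B^{\partial\Lambda}$ and all its truncations $\sum_{d\le n}\mathcal B_d^{\partial\Lambda}$ are Lindbladians. Put $\mathcal L^{\bar\Lambda}=\sum_{Z\subset\Lambda}\mathcal M_Z+\mathcal B^{\partial\Lambda}$ and $T_t^{\bar\Lambda}=e^{t\mathcal L^{\bar\Lambda}}$. The family is *frustration free* if for every finite $\Lambda$ and every state $\rho_\infty$ that is a fixed point of the evolution $T_t^{\bar\Lambda}$ one has $\mathcal M_Z(\rho_\infty)=0$ for all $Z\subset\Lambda$. Say that the boundary conditions *decay around* a finite set $S\subset\Gamma$, with respect to $\nu,b,c$, if $$\nu(r)\sum_{d\ge \max(r,1)}\big\|\mathcal B_d^{\partial S(N)}\big\|_\diamond\le c\,N^b\qquad\text{for all integers } N\ge1,\ r\ge0 .$$ The family satisfies the *Lieb–Robinson assumptions* with $\nu,v,b,c$ if $v,b,c>0$,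 the function $\nu:\mathbb N\to(0,\infty)$ is non-decreasing with $\nu(r+s)\le\nu(r)\nu(s)$, $$\sup_{x\in\Gamma}\sum_{Z\ni x}\|\mathcal M_Z\|_\diamond\,|Z|\,\nu(\operatorname{diam}Z)\le v ,$$ and the boundary conditions decay around every one-point set $\{x\}$, i.e. on all balls $\{x\}(N)=b_x(N)$, with respect to $\nu,b,c$. **Statement.** Let $A\subset\Gamma$ be finite and let $v,b,c$ be real numbers. There is a polynomial $P$, depending only on $D$, $A$, $v$, $b$, $c$, with the following property. Let $\mathcal L=(\mathcal M,\mathcal B)$ be a frustration-free uniform family that satisfies the Lieb–Robinson assumptions with $\nu,v,b,c$, and whose boundary conditions decay around $A$ with respect to $\nu,b,c$. (If $A$ is a ball, the last condition follows from the Lieb–Robinson assumptions after enlarging $c$ by a factor that depends only on $b$ and the radius of $A$.) Let $m\ge1$ be an integer, $B=A(m+1)$, $R=A(m+1)\setminus A(m)$, let $\rho_\infty^m$ be a state on $A(m)$ that is a fixed point of $T_t^{\overline{A(m)}}$, and let $\tau$ be any state on $R$. Then for all $t\ge0$ $$\Big\|\big(T_t^{\bar B}-T_t^{\bar B\setminus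 A}\big)(\rho_\infty^m\otimes\tau)\Big\|_1\le P(m)\,\frac1{\nu(m)}\,\big[e^{vt}-1+t\big],$$ where $T_t^{\bar B\setminus A}$ is the evolution generated by $$\mathcal L^{\bar B\setminus A}=\sum_{Z\subset B\setminus A}\mathcal M_Z+\sum_{1\le d\le m+1}\mathcal B_d^{\partial B}.$$ -/

import Mathlib

open scoped ENNReal Matrix ComplexOrder

noncomputable section

namespace OpenLattice

/-! ### The lattice `ℤ^D` with its graph metric -/

/-- The sites of the cubic lattice `ℤ^D`. -/
abbrev Site (D : ℕ) : Type := Fin D → ℤ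

variable {D : ℕ}

/-- The graph distance of the cubic lattice. -/
def gdist (x y : Site D) : ℕ := ∑ i, (x i - y i).natAbs

/-- The diameter of a finite set of sites in the graph distance. -/
def gdiam (Z : Finset (Site D)) : ℕ := Z.sup fun x => Z.sup fun y => gdist x y

/-- The ball `b_x(r)`. -/
def ball (x : Site D) (r : ℕ) : Finset (Site D) :=
  (Fintype.piFinset fun i => Finset.Icc (x i - r) (x i + r)).filter fun y => gdist x y ≤ r

/-- The neighbourhood `A(s)`: the sites at distance at most `s` from `A`. -/
def nbhd (A : Finset (Site D)) (s : ℕ) : Finset (Site D) := A.biUnion fun x => ball x s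

open Classical in
/-- The inner boundary `∂_d Λ`: the sites of `Λ` at distance at most `d` from the complement. -/
def bdry (d : ℕ) (Λ : Finset (Site D)) : Finset (Site D) :=
  Λ.filter fun x => ∃ y, y ∉ Λ ∧ gdist x y ≤ d

theorem mem_ball {x y : Site D} {r : ℕ} : y ∈ ball x r ↔ gdist x y ≤ r := by
  simp only [ball, Finset.mem_filter, Fintype.mem_piFinset, Finset.mem_Icc, and_iff_right_iff_imp]
  intro h i
  have h1 : (x i - y i).natAbs ≤ gdist x y :=
    Finset.single_le_sum (f := fun i => (x i - y i).natAbs) (fun _ _ => Nat.zero_le _)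
      (Finset.mem_univ i)
  omega

theorem mem_nbhd {A : Finset (Site D)} {s : ℕ} {y : Site D} :
    y ∈ nbhd A s ↔ ∃ x ∈ A, gdist x y ≤ s := by
  simp [nbhd, mem_ball]

theorem nbhd_mono (A : Finset (Site D)) {s t : ℕ} (h : s ≤ t) : nbhd A s ⊆ nbhd A t := by
  intro y hy
  obtain ⟨x, hx, hxy⟩ := mem_nbhd.1 hy
  exact mem_nbhd.2 ⟨x, hx, hxy.trans h⟩

theorem exists_between (x y : Site D) (k : ℕ) :
    ∃ z, gdist x z ≤ k ∧ gdist z y ≤ gdist x y - k := by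
  induction k with
  | zero => exact ⟨x, by simp [gdist], by simp⟩
  | succ k ih =>
    obtain ⟨z, h1, h2⟩ := ih
    by_cases hz : z = y
    · exact ⟨z, h1.trans (Nat.le_succ k), by simp [hz, gdist]⟩
    obtain ⟨i, hi⟩ := Function.ne_iff.1 hz
    refine ⟨Function.update z i (z i + (y i - z i).sign), ?_, ?_⟩
    · rw [gdist, ← Finset.add_sum_erase _ _ (Finset.mem_univ i)] at h1 ⊢
      rw [Finset.sum_congr rfl (g := fun j => (x j - z j).natAbs) fun j hj => by
        rw [Function.update_of_ne (Finset.ne_of_mem_erase hj)], Function.update_self]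
      rcases lt_or_gt_of_ne hi with h | h
      · rw [Int.sign_eq_one_of_pos (by omega)]; omega
      · rw [Int.sign_eq_neg_one_of_neg (by omega)]; omega
    · rw [gdist, ← Finset.add_sum_erase _ _ (Finset.mem_univ i)] at h2 ⊢
      rw [Finset.sum_congr rfl (g := fun j => (z j - y j).natAbs) fun j hj => by
        rw [Function.update_of_ne (Finset.ne_of_mem_erase hj)], Function.update_self]
      rcases lt_or_gt_of_ne hi with h | h
      · rw [Int.sign_eq_one_of_pos (by omega)]; omega
      · rw [Int.sign_eq_neg_one_of_neg (by omega)]; omega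

theorem gdist_triangle (x y z : Site D) : gdist x z ≤ gdist x y + gdist y z := by
  rw [gdist, gdist, gdist, ← Finset.sum_add_distrib]
  exact Finset.sum_le_sum fun i _ => by omega

theorem nbhd_ball (x : Site D) (k s : ℕ) : nbhd (ball x k) s = nbhd {x} (k + s) := by
  ext y
  simp only [mem_nbhd, mem_ball, Finset.mem_singleton, exists_eq_left]
  constructor
  · rintro ⟨z, h1, h2⟩
    exact (gdist_triangle x z y).trans (add_le_add h1 h2)
  · intro h
    obtain ⟨z, h1, h2⟩ := exists_between x y k
    exact ⟨z, h1, by omega⟩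

theorem bdry_subset (d : ℕ) (Λ : Finset (Site D)) : bdry d Λ ⊆ Λ := by
  classical exact Finset.filter_subset _ _

/-! ### Matrices and superoperators -/

section Matrices

variable {I : Type*} [Fintype I] [DecidableEq I]

/-- The trace norm `tr |X|`: the sum of the singular values of `X`, that is, of the square roots
of the eigenvalues of `Xᴴ X`. -/
def traceNorm (X : Matrix I I ℂ) : ℝ :=
  ∑ i, √((Matrix.isHermitian_conjTranspose_mul_self X).eigenvalues i)

/-- The superoperator `T ⊗ id_n`, acting blockwise. -/
def ampliation (n : ℕ) (T : Module.End ℂ (Matrix I I ℂ)) :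
    Module.End ℂ (Matrix (I × Fin n) (I × Fin n) ℂ) where
  toFun X := Matrix.of fun p p' => T (Matrix.of fun i i' => X (i, p.2) (i', p'.2)) p.1 p'.1
  map_add' X Y := by
    ext p p'
    exact congrFun₂ (T.map_add (Matrix.of fun i i' => X (i, p.2) (i', p'.2))
      (Matrix.of fun i i' => Y (i, p.2) (i', p'.2))) p.1 p'.1
  map_smul' a X := by
    ext p p'
    exact congrFun₂ (T.map_smul a (Matrix.of fun i i' => X (i, p.2) (i', p'.2))) p.1 p'.1

/-- The norm of a superoperator induced by the trace norm. -/
def oneNorm (T : Module.End ℂ (Matrix I I ℂ)) : ℝ≥0∞ :=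
  ⨆ (X : Matrix I I ℂ) (_ : traceNorm X ≤ 1), ENNReal.ofReal (traceNorm (T X))

/-- The diamond norm. -/
def diamondNorm (T : Module.End ℂ (Matrix I I ℂ)) : ℝ≥0∞ :=
  ⨆ n : ℕ, oneNorm (ampliation n T)

/-- A Lindbladian: a superoperator of the Lindblad-Kossakowski form. -/
def IsLindbladian (T : Module.End ℂ (Matrix I I ℂ)) : Prop :=
  ∃ (H : Matrix I I ℂ) (k : ℕ) (L : Fin k → Matrix I I ℂ), H.IsHermitian ∧
    ∀ ρ, T ρ = -Complex.I • (H * ρ - ρ * H) +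
      ∑ j, (L j * ρ * (L j)ᴴ - (1 / 2 : ℂ) • ((L j)ᴴ * L j * ρ + ρ * ((L j)ᴴ * L j)))

/-- A state, given by its density matrix. -/
def IsState (ρ : Matrix I I ℂ) : Prop := ρ.PosSemidef ∧ ρ.trace = 1

/-- The evolution `exp (t T)` applied to `X`, as the (always convergent) exponential series. -/
def evolve (T : Module.End ℂ (Matrix I I ℂ)) (t : ℝ) (X : Matrix I I ℂ) : Matrix I I ℂ :=
  ∑' n : ℕ, ((t ^ n / n.factorial : ℝ) : ℂ) • (T ^ n) X

end Matrices

/-! ### Operators on finite regions -/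

/-- The canonical product basis of the Hilbert space of `Λ`; the site `x` has dimension `q x`. -/
abbrev Config (q : Site D → ℕ) (Λ : Finset (Site D)) : Type := (x : Λ) → Fin (q x)

/-- The algebra of operators of the region `Λ`. -/
abbrev Op (q : Site D → ℕ) (Λ : Finset (Site D)) : Type := Matrix (Config q Λ) (Config q Λ) ℂ

/-- Superoperators of the region `Λ`. -/
abbrev SuperOp (q : Site D → ℕ) (Λ : Finset (Site D)) : Type := Module.End ℂ (Op q Λ)

variable {q : Site D → ℕ} {Z Λ : Finset (Site D)}

/-- The restriction of a configuration to a smaller region. -/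
def restr (h : Z ⊆ Λ) (σ : Config q Λ) : Config q Z := fun x => σ ⟨x, h x.2⟩

/-- The configuration that equals `a` on `Z` and `σ` elsewhere. -/
def glue (a : Config q Z) (σ : Config q Λ) : Config q Λ :=
  fun x => if h : (x : Site D) ∈ Z then a ⟨x, h⟩ else σ x

/-- The superoperator `T ⊗ id` of `Λ`, where `T` is a superoperator of `Z ⊆ Λ`. -/
def extend (h : Z ⊆ Λ) (T : SuperOp q Z) : SuperOp q Λ where
  toFun X := Matrix.of fun σ σ' =>
    T (Matrix.of fun a a' => X (glue a σ) (glue a' σ')) (restr h σ) (restr h σ')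
  map_add' X Y := by
    ext σ σ'
    exact congrFun₂ (T.map_add (Matrix.of fun a a' => X (glue a σ) (glue a' σ'))
      (Matrix.of fun a a' => Y (glue a σ) (glue a' σ'))) (restr h σ) (restr h σ')
  map_smul' a X := by
    ext σ σ'
    exact congrFun₂ (T.map_smul a (Matrix.of fun a a' => X (glue a σ) (glue a' σ')))
      (restr h σ) (restr h σ')

/-- The product operator `ρ ⊗ τ` on `Λ`, for `ρ` on `Z ⊆ Λ` and `τ` on `Λ \ Z`. -/
def tensor (h : Z ⊆ Λ) (ρ : Op q Z) (τ : Op q (Λ \ Z)) : Op q Λ :=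
  Matrix.of fun σ σ' => ρ (restr h σ) (restr h σ') *
    τ (restr Finset.sdiff_subset σ) (restr Finset.sdiff_subset σ')

/-! ### Uniform families -/

/-- The terms `B_d`, `d ≥ 1`, of a boundary condition of `Λ`, with `B_d` a superoperator of
`∂_d Λ`; their sum converges. -/
structure BoundaryTerms (q : Site D → ℕ) (Λ : Finset (Site D)) where
  /-- The term `B_d`; the index `d = 0` is never used. -/
  term : (d : ℕ) → SuperOp q (bdry d Λ)
  summable : ∀ X : Op q Λ,
    Summable fun d : ℕ => extend (bdry_subset (d + 1) Λ) (term (d + 1)) X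

namespace BoundaryTerms

variable (B : BoundaryTerms q Λ)

/-- The truncation `∑_{1 ≤ d ≤ n} B_d`, as a superoperator of `Λ`. -/
def upTo (n : ℕ) : SuperOp q Λ :=
  ∑ d ∈ Finset.Icc 1 n, extend (bdry_subset d Λ) (B.term d)

/-- The sum `∑_{d ≥ 1} B_d`, as a superoperator of `Λ`. -/
def total : SuperOp q Λ where
  toFun X := ∑' d : ℕ, extend (bdry_subset (d + 1) Λ) (B.term (d + 1)) X
  map_add' X Y := by
    simp only [map_add]
    exact (B.summable X).tsum_add (B.summable Y)
  map_smul' a X := by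
    simp only [map_smul, RingHom.id_apply]
    exact (B.summable X).tsum_const_smul a

end BoundaryTerms

/-- A uniform family of Lindbladians: a bulk interaction `M` and boundary conditions
`B^{∂Λ} = ∑_{d ≥ 1} B_d`. Each boundary condition, and each of its truncations, is a
Lindbladian. -/
structure UniformFamily (q : Site D → ℕ) where
  /-- The bulk terms. -/
  M : (Z : Finset (Site D)) → SuperOp q Z
  /-- The boundary terms. -/
  B : (Λ : Finset (Site D)) → BoundaryTerms q Λ
  isLindbladian_M : ∀ Z, IsLindbladian (M Z)
  isLindbladian_B : ∀ Λ, IsLindbladian (B Λ).total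
  isLindbladian_upTo : ∀ Λ n, IsLindbladian ((B Λ).upTo n)

namespace UniformFamily

variable (F : UniformFamily q)

/-- The sum of the bulk terms inside `S`, as a superoperator of `Λ ⊇ S`. -/
def bulk {S Λ : Finset (Site D)} (h : S ⊆ Λ) : SuperOp q Λ :=
  ∑ Z : S.powerset, extend ((Finset.mem_powerset.1 Z.2).trans h) (F.M Z)

/-- The generator of the closed boundary evolution of `Λ`. -/
def closed (Λ : Finset (Site D)) : SuperOp q Λ :=
  F.bulk (Finset.Subset.refl Λ) + (F.B Λ).total

/-- The generator on `Λ` that keeps the bulk terms inside `Λ \ A` and the boundary terms of `Λ`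
up to depth `k`. -/
def removed (Λ A : Finset (Site D)) (k : ℕ) : SuperOp q Λ :=
  F.bulk (S := Λ \ A) Finset.sdiff_subset + (F.B Λ).upTo k

/-- A state that is a fixed point of the closed boundary evolution of `Λ`. -/
def IsFixedPoint (Λ : Finset (Site D)) (ρ : Op q Λ) : Prop :=
  IsState ρ ∧ ∀ t : ℝ, 0 ≤ t → evolve (F.closed Λ) t ρ = ρ

/-- Frustration freeness: all bulk terms inside `Λ` annihilate all fixed points of the closed
boundary evolution of `Λ`. -/
def FrustrationFree : Prop :=
  ∀ (Λ : Finset (Site D)) (ρ : Op q Λ), F.IsFixedPoint Λ ρ →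
    ∀ (Z : Finset (Site D)) (h : Z ⊆ Λ), extend h (F.M Z) ρ = 0

/-- The decay of the boundary conditions of the neighbourhoods of `A`:
`ν(r) ∑_{d ≥ r} ‖B_d^{∂A(N)}‖ ≤ c N^b` for all `r` and all `N ≥ 1`. -/
def BoundaryDecay (ν : ℕ → ℝ) (b c : ℝ) (A : Finset (Site D)) : Prop :=
  ∀ N : ℕ, 1 ≤ N → ∀ r : ℕ,
    ENNReal.ofReal (ν r) *
      ∑' d : {d : ℕ // 1 ≤ d ∧ r ≤ d}, diamondNorm ((F.B (nbhd A N)).term d) ≤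
    ENNReal.ofReal (c * (N : ℝ) ^ b)

/-- The Lieb-Robinson assumptions, with decay function `ν` and constants `v`, `b`, `c`. In the
last one, the neighbourhood `{x}(N)` is the ball `b_x(N)`. -/
structure LiebRobinson (ν : ℕ → ℝ) (v b c : ℝ) : Prop where
  v_pos : 0 < v
  b_pos : 0 < b
  c_pos : 0 < c
  ν_pos : ∀ r, 0 < ν r
  ν_mono : Monotone ν
  ν_mul : ∀ r s, ν (r + s) ≤ ν r * ν s
  bulk_decay : ∀ x : Site D,
    ∑' Z : {Z : Finset (Site D) // x ∈ Z},
      diamondNorm (F.M Z) * (Z.1.card : ℝ≥0∞) * ENNReal.ofReal (ν (gdiam Z.1)) ≤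
    ENNReal.ofReal v
  boundary_decay : ∀ x : Site D, F.BoundaryDecay ν b c {x}

variable {F}

/-- For a ball, the decay of the boundary conditions of its neighbourhoods is part of the
Lieb-Robinson assumptions, after an enlargement of the constant `c`. -/
theorem LiebRobinson.exists_ball {ν : ℕ → ℝ} {v b c : ℝ} (hF : F.LiebRobinson ν v b c)
    (x : Site D) (k : ℕ) :
    ∃ c' : ℝ, F.LiebRobinson ν v b c' ∧ F.BoundaryDecay ν b c' (ball x k) := by
  have h1 : (1 : ℝ) ≤ ((k : ℝ) + 1) ^ b := Real.one_le_rpow (by simp) hF.b_pos.le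
  refine ⟨c * ((k : ℝ) + 1) ^ b, ⟨hF.v_pos, hF.b_pos, by have := hF.c_pos; positivity, hF.ν_pos,
    hF.ν_mono, hF.ν_mul, hF.bulk_decay, fun y N hN r => ?_⟩, fun N hN r => ?_⟩
  · refine (hF.boundary_decay y N hN r).trans (ENNReal.ofReal_le_ofReal ?_)
    have := hF.c_pos
    gcongr
    exact le_mul_of_one_le_right this.le h1
  · have h2 := hF.boundary_decay x (k + N) (by omega) r
    rw [← nbhd_ball] at h2
    refine h2.trans (ENNReal.ofReal_le_ofReal ?_)
    have := hF.c_pos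
    have hN' : (1 : ℝ) ≤ N := by exact_mod_cast hN
    rw [mul_assoc, ← Real.mul_rpow (by positivity) (by positivity)]
    gcongr
    · exact hF.b_pos.le
    · push_cast
      nlinarith

end UniformFamily

end OpenLattice

end

open OpenLattice

/-! Everything happens in the Schrödinger picture with the trace norm, for which Lindbladians
generate contractions (`IsLindbladian.norm_exp_le_one`). Put X = ρ ⊗ τ and let L, L' be the full and
the cut generator on B = A(m+1). They differ by the bulk terms that touch A and by the boundary
terms deeper than m+1. The latter have norm at most β/ν(m) with β = c(m+1)^b, so Duhamel's formula
(`norm_exp_sub_exp_le`) reduces the claim to the smallness of M_Z e^{tL} X for Z touching A.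

At t = 0 frustration freeness gives M_Z X = 0 for all Z ⊆ A(m). To control how the violation spreads
inwards (`propagation_step`, `propagation_bound`), write L = N + (bulk terms meeting Z) + R. Here N
collects the bulk terms disjoint from Z and the boundary terms too shallow to reach Z; it commutes
with M_Z and is a Lindbladian because truncated boundary conditions are. R is the remaining boundary
tail. So M_Z e^{tL} X solves a linear equation with contractive evolution N, whose source involves
only R and the same quantities for sets overlapping Z.

Weight each site x by ν(depth x), where depth is m - dist(x, A) cut off at zero. Submultiplicativity
gives ν(depth x) ≤ ν(diam Z) ν(depth y) for x, y in Z, and p(t) = sup_x ν(depth x) Σ_{Z ∋ x} ‖M_Z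
e^{tL} X‖ obeys p ≤ v(1 + ∫(p + β)). Hence p ≤ (v + β)e^{vt}. On A the weight is ν(m), and
integrating over time gives the result. -/

noncomputable section

namespace OpenLattice

/-! ### The trace norm -/

section TraceNorm

variable {I J K : Type*} [Fintype I] [Fintype J]

/-- The action of a matrix on a vector of the Hilbert space. -/
def act (V : Matrix I I ℂ) (a : EuclideanSpace ℂ I) : EuclideanSpace ℂ I :=
  WithLp.toLp 2 (V *ᵥ a.ofLp)

/-- The rank-one operator `|a⟩⟨b|`. -/
def ketBra (a b : EuclideanSpace ℂ I) : Matrix I I ℂ := Matrix.of fun i j => a i * star (b j)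

theorem sum_act (s : Finset K) (V : K → Matrix I I ℂ) (a : EuclideanSpace ℂ I) :
    act (∑ k ∈ s, V k) a = ∑ k ∈ s, act (V k) a := by
  simp only [act, Matrix.sum_mulVec, WithLp.toLp_sum]

theorem inner_act (V : Matrix I I ℂ) (a b : EuclideanSpace ℂ I) :
    inner ℂ (act V a) b = inner ℂ a (act Vᴴ b) := by
  simp only [EuclideanSpace.inner_eq_star_dotProduct, act, Matrix.star_mulVec]
  rw [dotProduct_comm, ← Matrix.dotProduct_mulVec, dotProduct_comm]

theorem act_act (V W : Matrix I I ℂ) (a : EuclideanSpace ℂ I) :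
    act V (act W a) = act (V * W) a := by
  simp only [act, Matrix.mulVec_mulVec]

theorem act_ketBra (a b v : EuclideanSpace ℂ I) :
    act (ketBra a b) v = inner ℂ b v • a := by
  ext i
  simp only [act, ketBra, Matrix.mulVec, dotProduct, Matrix.of_apply, PiLp.smul_apply, smul_eq_mul,
    PiLp.inner_apply, RCLike.inner_apply, Finset.sum_mul]
  refine Finset.sum_congr rfl fun j _ => ?_
  simp only [RCLike.star_def]
  ring

theorem norm_sq_act (V : Matrix I I ℂ) (a : EuclideanSpace ℂ I) :
    ((‖act V a‖ ^ 2 : ℝ) : ℂ) = inner ℂ a (act (Vᴴ * V) a) := by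
  rw [← act_act, ← inner_act, inner_self_eq_norm_sq_to_K]
  norm_cast

theorem mul_ketBra_mul (V W : Matrix I I ℂ) (a b : EuclideanSpace ℂ I) :
    V * ketBra a b * Wᴴ = ketBra (act V a) (act W b) := by
  ext i j
  simp only [Matrix.mul_apply, ketBra, Matrix.of_apply, act, Matrix.mulVec, dotProduct,
    Matrix.conjTranspose_apply, star_sum, star_mul', Finset.sum_mul, Finset.mul_sum]
  exact Finset.sum_congr rfl fun _ _ => Finset.sum_congr rfl fun _ _ => by ring

variable [DecidableEq I] [DecidableEq J]

/-- A singular value decomposition. -/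
theorem exists_ketBra_eq (X : Matrix I I ℂ) :
    ∃ a b : I → EuclideanSpace ℂ I, X = ∑ i, ketBra (a i) (b i) ∧ (∀ i, ‖b i‖ = 1) ∧
      (Pairwise fun i j => inner ℂ (a i) (a j) = 0) ∧ Orthonormal ℂ b ∧
      (∀ i, act X (b i) = a i) ∧ traceNorm X = ∑ i, ‖a i‖ := by
  set h := Matrix.isHermitian_conjTranspose_mul_self X with hdef
  have hv := h.eigenvectorBasis.orthonormal
  have he : ∀ j, act (Xᴴ * X) (h.eigenvectorBasis j) =
      (h.eigenvalues j : ℂ) • h.eigenvectorBasis j := by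
    intro j
    ext i
    have := congrFun (h.mulVec_eigenvectorBasis j) i
    simpa [act] using this
  refine ⟨fun i => act X (h.eigenvectorBasis i), fun i => h.eigenvectorBasis i, ?_, hv.1, ?_, hv,
    fun _ => rfl, ?_⟩
  -- Expand X = X U U* over the columns of U.
  · have hU : X * ((h.eigenvectorUnitary : Matrix I I ℂ) *
        star (h.eigenvectorUnitary : Matrix I I ℂ)) = X := by
      rw [Unitary.mul_star_self_of_mem h.eigenvectorUnitary.2, mul_one]
    conv_lhs => rw [← hU, ← mul_assoc]
    ext p q
    simp only [Matrix.mul_apply, Matrix.sum_apply, ketBra, Matrix.of_apply, act, Matrix.mulVec,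
      dotProduct, Matrix.star_apply, Matrix.IsHermitian.eigenvectorUnitary_apply]
  · intro i j hij
    simp only
    rw [inner_act, act_act, he, inner_smul_right, hv.2 hij, mul_zero]
  · refine Finset.sum_congr rfl fun i _ => ?_
    have h1 := norm_sq_act X (h.eigenvectorBasis i)
    rw [he, inner_smul_right, inner_self_eq_norm_sq_to_K, hv.1] at h1
    have h2 : ‖act X (h.eigenvectorBasis i)‖ ^ 2 = h.eigenvalues i := by
      apply Complex.ofReal_injective
      simpa using h1
    change √(h.eigenvalues i) = _
    rw [← h2, Real.sqrt_sq (norm_nonneg _)]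

/-- The trace norm is the least total weight of a decomposition into rank-one operators: write tr
|X| = Σ ⟨u_i, X v_i⟩ with orthonormal u and v, insert the decomposition, and use Bessel. The norm
axioms and all later trace norm bounds come from choosing a decomposition. -/
theorem traceNorm_le_of_eq_sum {s : Finset K} {X : Matrix I I ℂ} {a b : K → EuclideanSpace ℂ I}
    (hX : X = ∑ k ∈ s, ketBra (a k) (b k)) : traceNorm X ≤ ∑ k ∈ s, ‖a k‖ * ‖b k‖ := by
  obtain ⟨x, v, -, -, hx, hv, hXv, hn⟩ := exists_ketBra_eq X
  -- Vanishing singular values are dropped, since their left vectors cannot be normalized.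
  set S : Finset I := Finset.univ.filter fun i => x i ≠ 0
  let u : S → EuclideanSpace ℂ I := fun i => ((‖x i‖⁻¹ : ℝ) : ℂ) • x i
  have hu : Orthonormal ℂ u := by
    constructor
    · intro i
      have : x i ≠ 0 := (Finset.mem_filter.1 i.2).2
      simp only [u, norm_smul, Complex.norm_real, norm_inv, norm_norm]
      exact inv_mul_cancel₀ (norm_ne_zero_iff.2 this)
    · intro i j hij
      simp only [u, inner_smul_left, inner_smul_right]
      rw [hx (fun h => hij (Subtype.ext h))]
      simp
  have h1 : (traceNorm X : ℂ) = ∑ i : S, inner ℂ (u i) (act X (v i)) := by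
    have h0 : ∀ i, x i ≠ 0 ∨ ((‖x i‖ : ℝ) : ℂ) = 0 := fun i => by
      by_cases h : x i = 0 <;> simp [h]
    rw [hn, Complex.ofReal_sum, ← Finset.sum_filter_of_ne (p := fun i => x i ≠ 0)
      (fun i _ hi => (h0 i).resolve_right hi), ← Finset.sum_coe_sort]
    refine Finset.sum_congr rfl fun i _ => ?_
    have hi : (‖x i‖ : ℂ) ≠ 0 := by
      simpa using (Finset.mem_filter.1 i.2).2
    simp only [u, hXv, inner_smul_left, inner_self_eq_norm_sq_to_K, Complex.conj_ofReal]
    push_cast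
    field_simp
    rfl
  have h2 : ∀ i : S, inner ℂ (u i) (act X (v i)) =
      ∑ k ∈ s, inner ℂ (u i) (a k) * inner ℂ (b k) (v i) := by
    intro i
    rw [hX, sum_act, inner_sum]
    refine Finset.sum_congr rfl fun k _ => ?_
    rw [act_ketBra, inner_smul_right, mul_comm]
  have h3 : traceNorm X = ‖(traceNorm X : ℂ)‖ := by
    rw [Complex.norm_real, Real.norm_of_nonneg]
    exact Finset.sum_nonneg fun _ _ => Real.sqrt_nonneg _
  rw [h3, h1, Finset.sum_congr rfl fun i _ => h2 i, Finset.sum_comm]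
  refine (norm_sum_le _ _).trans (Finset.sum_le_sum fun k _ => ?_)
  refine (norm_sum_le _ _).trans ?_
  simp only [norm_mul]
  -- Cauchy-Schwarz in i, then Bessel for u against `a k` and for v against `b k`.
  refine (Real.sum_mul_le_sqrt_mul_sqrt _ _ _).trans ?_
  refine mul_le_mul (Real.sqrt_le_iff.2 ⟨norm_nonneg _, hu.sum_inner_products_le _⟩)
    (Real.sqrt_le_iff.2 ⟨norm_nonneg _, ?_⟩) (Real.sqrt_nonneg _) (norm_nonneg _)
  have := (hv.comp ((↑) : S → I) Subtype.val_injective).sum_inner_products_le (b k)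
    (s := Finset.univ)
  refine le_trans (le_of_eq ?_) this
  exact Finset.sum_congr rfl fun i _ => by rw [norm_inner_symm]; rfl

theorem traceNorm_nonneg (X : Matrix I I ℂ) : 0 ≤ traceNorm X :=
  Finset.sum_nonneg fun _ _ => Real.sqrt_nonneg _

theorem exists_ketBra_eq_traceNorm (X : Matrix I I ℂ) :
    ∃ a b : I → EuclideanSpace ℂ I, X = ∑ i, ketBra (a i) (b i) ∧
      ∑ i, ‖a i‖ * ‖b i‖ = traceNorm X := by
  obtain ⟨a, b, h1, h2, -, -, -, h3⟩ := exists_ketBra_eq X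
  exact ⟨a, b, h1, by simp only [h2, mul_one, h3]⟩

theorem traceNorm_add_le (X Y : Matrix I I ℂ) : traceNorm (X + Y) ≤ traceNorm X + traceNorm Y := by
  obtain ⟨a, b, h1, h2⟩ := exists_ketBra_eq_traceNorm X
  obtain ⟨a', b', h1', h2'⟩ := exists_ketBra_eq_traceNorm Y
  have := traceNorm_le_of_eq_sum (s := Finset.univ) (X := X + Y)
    (a := Sum.elim a a') (b := Sum.elim b b') (by simp [← h1, ← h1'])
  simpa [h2, h2'] using this

theorem traceNorm_smul_le (z : ℂ) (X : Matrix I I ℂ) : traceNorm (z • X) ≤ ‖z‖ * traceNorm X := by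
  obtain ⟨a, b, h1, h2⟩ := exists_ketBra_eq_traceNorm X
  have := traceNorm_le_of_eq_sum (s := Finset.univ) (X := z • X) (a := fun i => z • a i) (b := b) (by
    rw [h1, Finset.smul_sum]
    refine Finset.sum_congr rfl fun i _ => ?_
    ext p q
    simp [ketBra, mul_assoc])
  simpa [norm_smul, mul_assoc, ← Finset.mul_sum, h2] using this

theorem eq_zero_of_traceNorm_eq_zero {X : Matrix I I ℂ} (h : traceNorm X = 0) : X = 0 := by
  obtain ⟨a, b, h1, h2⟩ := exists_ketBra_eq_traceNorm X
  rw [h, Finset.sum_eq_zero_iff_of_nonneg fun _ _ => by positivity] at h2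
  rw [h1]
  refine Finset.sum_eq_zero fun i hi => ?_
  ext p q
  rcases mul_eq_zero.1 (h2 i hi) with h | h <;> simp [ketBra, norm_eq_zero.1 h]

theorem traceNorm_zero : traceNorm (0 : Matrix I I ℂ) = 0 :=
  le_antisymm (by simpa using traceNorm_smul_le 0 (0 : Matrix I I ℂ)) (traceNorm_nonneg _)

theorem traceNorm_neg (X : Matrix I I ℂ) : traceNorm (-X) = traceNorm X := by
  refine le_antisymm ?_ ?_
  · simpa using traceNorm_smul_le (-1) X
  · simpa using traceNorm_smul_le (-1) (-X)

theorem traceNorm_submatrix_le (e : J ≃ I) (X : Matrix I I ℂ) :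
    traceNorm (X.submatrix e e) ≤ traceNorm X := by
  obtain ⟨a, b, h1, h2⟩ := exists_ketBra_eq_traceNorm X
  have := traceNorm_le_of_eq_sum (s := Finset.univ) (X := X.submatrix e e)
    (a := fun i => WithLp.toLp 2 fun j => a i (e j))
    (b := fun i => WithLp.toLp 2 fun j => b i (e j)) (by
      conv_lhs => rw [h1]
      ext p q
      simp [Matrix.sum_apply, ketBra])
  refine this.trans (le_of_eq ?_)
  rw [← h2]
  have h3 (a : EuclideanSpace ℂ I) : ‖(WithLp.toLp 2 fun j => a (e j) : EuclideanSpace ℂ J)‖ =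
      ‖a‖ := by
    simp only [EuclideanSpace.norm_eq]
    rw [Equiv.sum_comp e fun i => ‖a i‖ ^ 2]
  simp only [h3]

theorem traceNorm_submatrix (e : J ≃ I) (X : Matrix I I ℂ) :
    traceNorm (X.submatrix e e) = traceNorm X := by
  refine le_antisymm (traceNorm_submatrix_le e X) ?_
  simpa using traceNorm_submatrix_le e.symm (X.submatrix e e)

open scoped MatrixOrder Matrix.Norms.L2Operator in
theorem exists_eq_conjTranspose_mul_self {X : Matrix I I ℂ} (hX : X.PosSemidef) :
    ∃ Y : Matrix I I ℂ, X = Yᴴ * Y :=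
  CStarAlgebra.nonneg_iff_eq_star_mul_self.mp hX.nonneg

/-- With X = Y*Y, the conjugated rows of Y give a rank-one decomposition of weight Σ |Y_ij|² = tr X.
-/
theorem traceNorm_le_trace {X : Matrix I I ℂ} (hX : X.PosSemidef) : traceNorm X ≤ X.trace.re := by
  obtain ⟨Y, rfl⟩ := exists_eq_conjTranspose_mul_self hX
  have := traceNorm_le_of_eq_sum (s := Finset.univ) (X := Yᴴ * Y)
    (a := fun i => WithLp.toLp 2 fun j => star (Y i j))
    (b := fun i => WithLp.toLp 2 fun j => star (Y i j)) (by
      ext p q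
      simp [Matrix.mul_apply, Matrix.sum_apply, ketBra])
  refine this.trans (le_of_eq ?_)
  simp only [← sq, EuclideanSpace.norm_sq_eq, norm_star, Matrix.trace, Matrix.diag,
    Matrix.mul_apply, Matrix.conjTranspose_apply, Complex.re_sum]
  rw [Finset.sum_comm]
  refine Finset.sum_congr rfl fun i _ => Finset.sum_congr rfl fun j _ => ?_
  rw [RCLike.star_def, ← Complex.normSq_eq_conj_mul_self, Complex.ofReal_re,
    Complex.normSq_eq_norm_sq]

/-- A sum of conjugations is bounded in trace norm if its dual is bounded at the identity. -/
theorem traceNorm_sum_conj_le {s : Finset K} (V : K → Matrix I I ℂ) {C : ℝ}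
    (hV : ∀ a, ∑ k ∈ s, ‖act (V k) a‖ ^ 2 ≤ C * ‖a‖ ^ 2) (X : Matrix I I ℂ) :
    traceNorm (∑ k ∈ s, V k * X * (V k)ᴴ) ≤ C * traceNorm X := by
  obtain ⟨a, b, h1, h2⟩ := exists_ketBra_eq_traceNorm X
  have := traceNorm_le_of_eq_sum (s := s ×ˢ Finset.univ) (X := ∑ k ∈ s, V k * X * (V k)ᴴ)
    (a := fun p => act (V p.1) (a p.2)) (b := fun p => act (V p.1) (b p.2)) (by
      rw [Finset.sum_product]
      refine Finset.sum_congr rfl fun k _ => ?_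
      simp only [← mul_ketBra_mul, ← Finset.sum_mul, ← Finset.mul_sum, ← h1])
  refine this.trans ?_
  -- For each rank-one piece of X, Cauchy-Schwarz over the conjugations k costs only the factor C.
  rw [Finset.sum_product_right, ← h2, Finset.mul_sum]
  refine Finset.sum_le_sum fun i _ => ?_
  refine (Real.sum_mul_le_sqrt_mul_sqrt _ _ _).trans ?_
  refine (mul_le_mul (Real.sqrt_le_sqrt (hV (a i))) (Real.sqrt_le_sqrt (hV (b i)))
    (Real.sqrt_nonneg _) (Real.sqrt_nonneg _)).trans ?_
  by_cases hz : a i = 0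
  · simp [hz]
  have hC : 0 ≤ C := by
    have h3 := (Finset.sum_nonneg fun k _ => sq_nonneg ‖act (V k) (a i)‖).trans (hV (a i))
    exact nonneg_of_mul_nonneg_left h3 (by positivity)
  rw [Real.sqrt_mul hC, Real.sqrt_mul hC, Real.sqrt_sq (norm_nonneg _),
    Real.sqrt_sq (norm_nonneg _)]
  refine le_of_eq ?_
  calc _ = (√C * √C) * (‖a i‖ * ‖b i‖) := by ring
    _ = _ := by rw [Real.mul_self_sqrt hC]

end TraceNorm

/-! ### Contraction semigroups on a Banach space -/

section Semigroup

open NormedSpace Filter Topology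

variable {E : Type*} [NormedAddCommGroup E] [NormedSpace ℝ E] [CompleteSpace E]

/-- A generator whose Euler steps are contractive up to second order generates a contraction
semigroup. -/
theorem norm_exp_smul_le_one {N : E →L[ℝ] E} {C : ℝ}
    (h : ∀ ε : ℝ, 0 ≤ ε → ‖1 + ε • N‖ ≤ 1 + C * ε ^ 2) {t : ℝ} (ht : 0 ≤ t) :
    ‖exp (t • N)‖ ≤ 1 := by
  -- exp(uN) differs from the Euler step 1 + uN by o(u), so any exponential rate η > 0 suffices for
  -- short times; splitting t into n short steps then extends this to time t, and finally η → 0.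
  have hstep : ∀ η : ℝ, 0 < η → ∀ᶠ u in 𝓝 (0 : ℝ), 0 ≤ u → ‖exp (u • N)‖ ≤ Real.exp (η * u) := by
    intro η hη
    have h1 := (hasDerivAt_exp_smul_const N (0 : ℝ)).isLittleO
    have h2 := h1.bound (half_pos hη)
    have h3 : Tendsto (fun u : ℝ => C * u) (𝓝 0) (𝓝 0) := by
      simpa using (continuous_const.mul continuous_id).tendsto (0 : ℝ) (f := fun u : ℝ => C * u)
    filter_upwards [h2, h3.eventually (gt_mem_nhds (half_pos hη))] with u hu hu' hu0
    simp only [zero_smul, exp_zero, one_mul, sub_zero, Real.norm_of_nonneg hu0] at hu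
    have h4 : exp (u • N) = (exp (u • N) - 1 - u • N) + (1 + u • N) := by abel
    rw [h4]
    refine (norm_add_le _ _).trans ?_
    have h5 := h u hu0
    have h6 := Real.add_one_le_exp (η * u)
    nlinarith
  have hη : ∀ η : ℝ, 0 < η → ‖exp (t • N)‖ ≤ Real.exp (η * t) := by
    intro η hη
    have h1 : Tendsto (fun n : ℕ => t / n) atTop (𝓝 0) := tendsto_const_div_atTop_nhds_zero_nat t
    obtain ⟨n, hn, hn0⟩ := ((h1.eventually (hstep η hη)).and (eventually_gt_atTop 0)).exists
    have hn' : (n : ℝ) ≠ 0 := by exact_mod_cast hn0.ne'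
    have h2 : exp (t • N) = exp ((t / n) • N) ^ n := by
      let := NormedAlgebra.restrictScalars ℚ ℝ (E →L[ℝ] E)
      rw [← NormedSpace.exp_nsmul, ← Nat.cast_smul_eq_nsmul ℝ, smul_smul, mul_div_cancel₀ _ hn']
    rw [h2]
    refine (norm_pow_le' _ hn0).trans ?_
    refine (pow_le_pow_left₀ (norm_nonneg _) (hn (by positivity)) n).trans (le_of_eq ?_)
    rw [← Real.exp_nat_mul]
    congr 1
    field_simp
  have h1 : Tendsto (fun η : ℝ => Real.exp (η * t)) (𝓝[>] 0) (𝓝 1) := by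
    have : Continuous fun η : ℝ => Real.exp (η * t) := by fun_prop
    simpa using (this.tendsto 0).mono_left nhdsWithin_le_nhds
  exact ge_of_tendsto h1 (by filter_upwards [self_mem_nhdsWithin] with η h using hη η h)

theorem hasDerivAt_exp_smul_apply (N : E →L[ℝ] E) (x : E) (t : ℝ) :
    HasDerivAt (fun s : ℝ => exp (s • N) x) (N (exp (t • N) x)) t := by
  simpa using (hasDerivAt_exp_smul_const' N t).clm_apply (hasDerivAt_const t x)

/-- Duhamel's estimate for an inhomogeneous linear equation with contractive evolution. -/
theorem norm_le_of_hasDerivAt {N : E →L[ℝ] E} (hN : ∀ t : ℝ, 0 ≤ t → ‖exp (t • N)‖ ≤ 1)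
    {f r : ℝ → E} {Φ φ : ℝ → ℝ} (hf : ∀ s, HasDerivAt f (N (f s) + r s) s)
    (hΦ : ∀ s, HasDerivAt Φ (φ s) s) (hr : ∀ s, 0 ≤ s → ‖r s‖ ≤ φ s) (h0 : ‖f 0‖ ≤ Φ 0)
    {t : ℝ} (ht : 0 ≤ t) : ‖f t‖ ≤ Φ t := by
  -- Interaction picture: in exp((t - s)N) f(s) the drift N cancels and only the source remains.
  have hd : ∀ s, HasDerivAt (fun s => exp ((t - s) • N) (f s)) (exp ((t - s) • N) (r s)) s := by
    intro s
    have h1 : HasDerivAt (fun s => exp ((t - s) • N)) (-(exp ((t - s) • N) * N)) s := by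
      have := (hasDerivAt_exp_smul_const N (t - s)).scomp s ((hasDerivAt_id s).const_sub t)
      simpa [Function.comp_def] using this
    have h2 := h1.clm_apply (hf s)
    simpa using h2
  have h := image_norm_le_of_norm_deriv_right_le_deriv_boundary
    (f := fun s => exp ((t - s) • N) (f s)) (f' := fun s => exp ((t - s) • N) (r s))
    (a := 0) (b := t) (B := Φ) (B' := φ) (fun s _ => (hd s).continuousAt.continuousWithinAt)
    (fun s _ => (hd s).hasDerivWithinAt) ?_ hΦ ?_ (Set.right_mem_Icc.2 ht)
  · simpa using h
  · refine le_trans ?_ h0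
    simpa using (ContinuousLinearMap.le_opNorm _ _).trans
      (mul_le_of_le_one_left (norm_nonneg (f 0)) (hN (t - 0) (by simpa using ht)))
  · intro s hs
    exact ((ContinuousLinearMap.le_opNorm _ _).trans
      (mul_le_of_le_one_left (norm_nonneg _) (hN _ (sub_nonneg.2 hs.2.le)))).trans (hr s hs.1)

end Semigroup

/-! ### The Banach space of operators with the trace norm -/

section TraceClass

variable {I : Type*} [Fintype I] [DecidableEq I]

/-- The operators on the Hilbert space with basis `I`, normed by the trace norm. -/
def TraceClass (I : Type*) : Type _ := Matrix I I ℂ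

instance : AddCommGroup (TraceClass I) := inferInstanceAs (AddCommGroup (Matrix I I ℂ))

instance : Module ℂ (TraceClass I) := inferInstanceAs (Module ℂ (Matrix I I ℂ))

instance : FiniteDimensional ℂ (TraceClass I) :=
  inferInstanceAs (FiniteDimensional ℂ (Matrix I I ℂ))

instance : NormedAddCommGroup (TraceClass I) :=
  AddGroupNorm.toNormedAddCommGroup
    { toFun := fun X => traceNorm (I := I) X
      map_zero' := traceNorm_zero
      add_le' := traceNorm_add_le
      neg' := traceNorm_neg
      eq_zero_of_map_eq_zero' := fun _ => eq_zero_of_traceNorm_eq_zero }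

instance : NormedSpace ℂ (TraceClass I) where
  norm_smul_le := traceNorm_smul_le (I := I)

instance : CompleteSpace (TraceClass I) := FiniteDimensional.complete ℂ _

/-- The identity map onto the trace class. -/
def toTraceClass : Matrix I I ℂ ≃ₗ[ℂ] TraceClass I := LinearEquiv.refl ℂ (Matrix I I ℂ)

theorem norm_toTraceClass (X : Matrix I I ℂ) : ‖toTraceClass X‖ = traceNorm X := rfl

/-- A superoperator as a bounded operator on the trace class. -/
def superCLM : Module.End ℂ (Matrix I I ℂ) →ₗ[ℂ] TraceClass I →L[ℝ] TraceClass I where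
  toFun T := (LinearMap.toContinuousLinearMap (E := TraceClass I) (F' := TraceClass I)
    (toTraceClass.conj T)).restrictScalars ℝ
  map_add' _ _ := rfl
  map_smul' _ _ := rfl

theorem superCLM_apply (T : Module.End ℂ (Matrix I I ℂ)) (X : Matrix I I ℂ) :
    superCLM T (toTraceClass X) = toTraceClass (T X) := rfl

theorem superCLM_mul (S T : Module.End ℂ (Matrix I I ℂ)) :
    superCLM (S * T) = superCLM S * superCLM T := rfl

theorem superCLM_pow (T : Module.End ℂ (Matrix I I ℂ)) (n : ℕ) :
    superCLM (T ^ n) = superCLM T ^ n := by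
  induction n with
  | zero => rfl
  | succ n ih => rw [pow_succ, pow_succ, superCLM_mul, ih]

theorem norm_superCLM_le {T : Module.End ℂ (Matrix I I ℂ)} {C : ℝ} (hC : 0 ≤ C)
    (h : ∀ X, traceNorm (T X) ≤ C * traceNorm X) : ‖superCLM T‖ ≤ C :=
  ContinuousLinearMap.opNorm_le_bound _ hC h

/-- The series in `evolve` is summed in the entrywise topology, the exponential in operator norm; in
finite dimension the identification is a homeomorphism, so the sums agree. -/
theorem toTraceClass_evolve (T : Module.End ℂ (Matrix I I ℂ)) (t : ℝ) (X : Matrix I I ℂ) :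
    toTraceClass (evolve T t X) = NormedSpace.exp (t • superCLM T) (toTraceClass X) := by
  have h1 := NormedSpace.exp_series_hasSum_exp' (𝕂 := ℝ) (t • superCLM T)
  have h2 := (ContinuousLinearMap.apply ℝ (TraceClass I) (toTraceClass X)).hasSum h1
  let e : TraceClass I ≃L[ℂ] Matrix I I ℂ := toTraceClass.symm.toContinuousLinearEquiv
  have h3 := (e : TraceClass I →L[ℂ] Matrix I I ℂ).hasSum h2
  rw [evolve]
  have h4 : HasSum (fun n : ℕ => ((t ^ n / n.factorial : ℝ) : ℂ) • (T ^ n) X)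
      (e (NormedSpace.exp (t • superCLM T) (toTraceClass X))) := by
    convert h3 using 2 with n
    · rw [smul_pow, ← superCLM_pow, smul_smul, div_eq_inv_mul]
      rfl
    · rfl
  rw [h4.tsum_eq]
  rfl

/-- A superoperator is bounded by its induced norm. -/
theorem traceNorm_apply_le {T : Module.End ℂ (Matrix I I ℂ)} (hT : oneNorm T ≠ ∞)
    (X : Matrix I I ℂ) : traceNorm (T X) ≤ (oneNorm T).toReal * traceNorm X := by
  by_cases h : traceNorm X = 0
  · rw [eq_zero_of_traceNorm_eq_zero h, map_zero, traceNorm_zero, mul_zero]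
  have h0 : 0 < traceNorm X := lt_of_le_of_ne (traceNorm_nonneg X) (Ne.symm h)
  have h1 : traceNorm (((traceNorm X)⁻¹ : ℂ) • X) ≤ 1 := by
    refine (traceNorm_smul_le _ _).trans (le_of_eq ?_)
    rw [norm_inv, Complex.norm_real, Real.norm_of_nonneg h0.le, inv_mul_cancel₀ h]
  have h2 : ENNReal.ofReal (traceNorm (T (((traceNorm X)⁻¹ : ℂ) • X))) ≤ oneNorm T :=
    le_iSup₂_of_le (f := fun (X : Matrix I I ℂ) (_ : traceNorm X ≤ 1) =>
      ENNReal.ofReal (traceNorm (T X))) _ h1 le_rfl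
  have h3 := (ENNReal.ofReal_le_iff_le_toReal hT).1 h2
  have h4 : T X = (traceNorm X : ℂ) • T (((traceNorm X)⁻¹ : ℂ) • X) := by
    rw [map_smul, smul_smul, mul_inv_cancel₀ (by exact_mod_cast h), one_smul]
  rw [h4, mul_comm]
  refine (traceNorm_smul_le _ _).trans ?_
  rw [Complex.norm_real, Real.norm_of_nonneg h0.le]
  exact mul_le_mul_of_nonneg_left h3 h0.le

theorem exists_norm_act_le (G : Matrix I I ℂ) : ∃ C : ℝ, 0 ≤ C ∧ ∀ a, ‖act G a‖ ^ 2 ≤ C * ‖a‖ ^ 2 := by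
  let g := LinearMap.toContinuousLinearMap (Matrix.toLpLin 2 2 G)
  refine ⟨‖g‖ ^ 2, by positivity, fun a => ?_⟩
  rw [← mul_pow]
  exact pow_le_pow_left₀ (norm_nonneg _) (g.le_opNorm a) 2

/-- Lindbladians generate contraction semigroups for the trace norm. -/
theorem IsLindbladian.norm_exp_le_one {T : Module.End ℂ (Matrix I I ℂ)} (hT : IsLindbladian T)
    {t : ℝ} (ht : 0 ≤ t) : ‖NormedSpace.exp (t • superCLM T)‖ ≤ 1 := by
  obtain ⟨H, k, L, hH, hT⟩ := hT
  set S : Matrix I I ℂ := ∑ j, (L j)ᴴ * L j with hS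
  -- The no-jump generator: T X = G X + X G* + Σ L_j X L_j*, with G + G* = -S expressing trace
  -- preservation.
  set G : Matrix I I ℂ := -Complex.I • H - (1 / 2 : ℂ) • S with hG
  have hSS : Sᴴ = S := by simp [hS, Matrix.conjTranspose_sum]
  have hGH : Gᴴ = Complex.I • H - (1 / 2 : ℂ) • S := by
    rw [hG, Matrix.conjTranspose_sub, Matrix.conjTranspose_smul, Matrix.conjTranspose_smul, hSS,
      hH.eq]
    simp
  have hT' : ∀ X, T X = G * X + X * Gᴴ + ∑ j, L j * X * (L j)ᴴ := by
    intro X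
    rw [hT, Finset.sum_sub_distrib, ← Finset.smul_sum, Finset.sum_add_distrib, ← Finset.sum_mul,
      ← Finset.mul_sum, ← hS, hGH, hG]
    simp only [sub_mul, mul_sub, smul_mul_assoc, mul_smul_comm]
    module
  obtain ⟨C, hC, hGC⟩ := exists_norm_act_le G
  refine norm_exp_smul_le_one (C := 2 * C) (fun ε hε => ?_) ht
  -- Kraus operators 1 + εG and √ε L_j reproduce the Euler step up to ε² G X G*, and Σ V*V = 1 + ε²
  -- G*G. Each of these two errors contributes Cε², hence the constant 2C.
  let V : Option (Fin k) → Matrix I I ℂ := fun o =>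
    o.elim (1 + (ε : ℂ) • G) fun j => ((√ε : ℝ) : ℂ) • L j
  have hεε : ((√ε : ℝ) : ℂ) * ((√ε : ℝ) : ℂ) = ε := by
    rw [← Complex.ofReal_mul, Real.mul_self_sqrt hε]
  have hVX : ∀ X, X + (ε : ℂ) • T X =
      ∑ o, V o * X * (V o)ᴴ - ((ε ^ 2 : ℝ) : ℂ) • (G * X * Gᴴ) := by
    intro X
    rw [Fintype.sum_option, hT']
    simp only [V, Option.elim, Matrix.conjTranspose_add, Matrix.conjTranspose_smul,
      Matrix.conjTranspose_one, RCLike.star_def, Complex.conj_ofReal, add_mul, mul_add, one_mul,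
      mul_one, smul_mul_assoc, mul_smul_comm, smul_smul, hεε, ← Finset.smul_sum]
    push_cast
    module
  have hVV : ∑ o, (V o)ᴴ * V o = 1 + ((ε ^ 2 : ℝ) : ℂ) • (Gᴴ * G) := by
    rw [Fintype.sum_option]
    simp only [V, Option.elim, Matrix.conjTranspose_add, Matrix.conjTranspose_smul,
      Matrix.conjTranspose_one, RCLike.star_def, Complex.conj_ofReal, add_mul, mul_add, one_mul,
      mul_one, smul_mul_assoc, mul_smul_comm, smul_smul, hεε, ← Finset.smul_sum, ← hS]
    have h1 : S = -(G + Gᴴ) := by rw [hGH, hG]; module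
    conv_lhs => rw [h1]
    push_cast
    module
  have hV : ∀ a, ∑ o, ‖act (V o) a‖ ^ 2 ≤ (1 + C * ε ^ 2) * ‖a‖ ^ 2 := by
    intro a
    have h1 : ((∑ o, ‖act (V o) a‖ ^ 2 : ℝ) : ℂ) = ((‖a‖ ^ 2 + ε ^ 2 * ‖act G a‖ ^ 2 : ℝ) : ℂ) := by
      rw [Complex.ofReal_sum, Finset.sum_congr rfl fun o _ => norm_sq_act (V o) a, ← inner_sum,
        ← sum_act, hVV, Complex.ofReal_add, Complex.ofReal_mul, norm_sq_act]
      have h2 : act (1 + ((ε ^ 2 : ℝ) : ℂ) • (Gᴴ * G)) a =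
          a + ((ε ^ 2 : ℝ) : ℂ) • act (Gᴴ * G) a := by
        simp [act, Matrix.add_mulVec, Matrix.smul_mulVec]
      rw [h2, inner_add_right, inner_smul_right, inner_self_eq_norm_sq_to_K]
      norm_cast
    rw [Complex.ofReal_injective h1]
    nlinarith [hGC a, sq_nonneg ε]
  have hn := traceNorm_sum_conj_le (s := Finset.univ) V hV
  have hn' := traceNorm_sum_conj_le (s := {()}) (fun _ => G) (C := C) (by simpa using hGC)
  simp only [Finset.sum_singleton] at hn'
  have h1 : (1 : TraceClass I →L[ℝ] TraceClass I) + ε • superCLM T =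
      superCLM (1 + (ε : ℂ) • T) := rfl
  rw [h1]
  refine norm_superCLM_le (by positivity) fun X => ?_
  have h2 : (1 + (ε : ℂ) • T) X = X + (ε : ℂ) • T X := rfl
  rw [h2, hVX, sub_eq_add_neg]
  refine (traceNorm_add_le _ _).trans ?_
  rw [traceNorm_neg]
  have h3 := traceNorm_smul_le ((ε ^ 2 : ℝ) : ℂ) (G * X * Gᴴ)
  rw [Complex.norm_real, Real.norm_of_nonneg (by positivity)] at h3
  nlinarith [hn X, hn' X, sq_nonneg ε]

end TraceClass

/-! ### Lindbladians -/

section Inflate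

variable {I J : Type*}

/-- The operator `X ⊗ 1`, along an identification of `J` with `I × Fin n`. -/
def inflate {n : ℕ} (e : J ≃ I × Fin n) (X : Matrix I I ℂ) : Matrix J J ℂ :=
  (Matrix.kroneckerMap (· * ·) X (1 : Matrix (Fin n) (Fin n) ℂ)).submatrix e e

theorem inflate_conjTranspose {n : ℕ} (e : J ≃ I × Fin n) (X : Matrix I I ℂ) :
    inflate e Xᴴ = (inflate e X)ᴴ := by
  rw [inflate, inflate, Matrix.conjTranspose_submatrix, Matrix.conjTranspose_kronecker,
    Matrix.conjTranspose_one]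

variable [Fintype I] [Fintype J]

theorem inflate_mul {n : ℕ} (e : J ≃ I × Fin n) (X Y : Matrix I I ℂ) :
    inflate e (X * Y) = inflate e X * inflate e Y := by
  rw [inflate, inflate, inflate, Matrix.submatrix_mul_equiv, ← Matrix.mul_kronecker_mul, one_mul]

theorem inflate_mul_apply {n : ℕ} (e : J ≃ I × Fin n) (A : Matrix I I ℂ) (X : Matrix J J ℂ)
    (p q : J) : (inflate e A * X) p q =
      ∑ i, A (e p).1 i * X (e.symm (i, (e p).2)) q := by
  rw [Matrix.mul_apply, ← e.symm.sum_comp, Fintype.sum_prod_type]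
  refine Finset.sum_congr rfl fun i _ => ?_
  rw [Finset.sum_eq_single (e p).2]
  · simp [inflate]
  · intro j _ hj
    simp [inflate, Matrix.one_apply_ne (Ne.symm hj)]
  · simp

theorem mul_inflate_apply {n : ℕ} (e : J ≃ I × Fin n) (A : Matrix I I ℂ) (X : Matrix J J ℂ)
    (p q : J) : (X * inflate e A) p q =
      ∑ i, X p (e.symm (i, (e q).2)) * A i (e q).1 := by
  rw [Matrix.mul_apply, ← e.symm.sum_comp, Fintype.sum_prod_type]
  refine Finset.sum_congr rfl fun i _ => ?_
  rw [Finset.sum_eq_single (e q).2]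
  · simp [inflate]
  · intro j _ hj
    simp [inflate, Matrix.one_apply_ne hj]
  · simp

end Inflate

section Lindbladian

variable {I J : Type*} [Fintype I] [Fintype J]

theorem IsLindbladian.zero : IsLindbladian (0 : Module.End ℂ (Matrix I I ℂ)) :=
  ⟨0, 0, Fin.elim0, Matrix.isHermitian_zero, fun ρ => by simp⟩

theorem IsLindbladian.add {S T : Module.End ℂ (Matrix I I ℂ)} (hS : IsLindbladian S)
    (hT : IsLindbladian T) : IsLindbladian (S + T) := by
  obtain ⟨H, k, L, hH, hS⟩ := hS
  obtain ⟨H', k', L', hH', hT⟩ := hT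
  refine ⟨H + H', k + k', Fin.append L L', hH.add hH', fun ρ => ?_⟩
  rw [LinearMap.add_apply, hS, hT, Fin.sum_univ_add]
  simp only [Fin.append_left, Fin.append_right, add_mul, mul_add]
  module

theorem IsLindbladian.sum {K : Type*} {s : Finset K} {T : K → Module.End ℂ (Matrix I I ℂ)}
    (h : ∀ k ∈ s, IsLindbladian (T k)) : IsLindbladian (∑ k ∈ s, T k) :=
  Finset.sum_induction _ _ (fun _ _ => IsLindbladian.add) IsLindbladian.zero h

/-- The superoperator `T ⊗ id_n`, along an identification of `J` with `I × Fin n`. -/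
def reampliation {n : ℕ} (e : J ≃ I × Fin n) (T : Module.End ℂ (Matrix I I ℂ)) (X : Matrix J J ℂ) :
    Matrix J J ℂ :=
  (ampliation n T (X.submatrix e.symm e.symm)).submatrix e e

/-- The operators H ⊗ 1 and L_j ⊗ 1 give the Lindblad form of T ⊗ id. -/
theorem IsLindbladian.reampliation {n : ℕ} (e : J ≃ I × Fin n) {T : Module.End ℂ (Matrix I I ℂ)}
    {T' : Module.End ℂ (Matrix J J ℂ)} (hT : IsLindbladian T)
    (h : ∀ X, T' X = OpenLattice.reampliation e T X) : IsLindbladian T' := by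
  obtain ⟨H, k, L, hH, hT⟩ := hT
  refine ⟨inflate e H, k, fun j => inflate e (L j), ?_, fun X => ?_⟩
  · rw [Matrix.IsHermitian, ← inflate_conjTranspose, hH.eq]
  · ext p q
    rw [h, OpenLattice.reampliation, Matrix.submatrix_apply]
    have h1 : ampliation n T (X.submatrix e.symm e.symm) (e p) (e q) =
        T (Matrix.of fun i i' => X (e.symm (i, (e p).2)) (e.symm (i', (e q).2)))
          (e p).1 (e q).1 := rfl
    rw [h1, hT]
    simp only [← inflate_conjTranspose, ← inflate_mul, Matrix.add_apply, Matrix.sub_apply,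
      Matrix.smul_apply, Matrix.sum_apply, inflate_mul_apply, mul_inflate_apply]
    simp only [Matrix.mul_apply, Matrix.of_apply, Prod.mk.eta, Equiv.symm_apply_apply]

variable [DecidableEq I] [DecidableEq J]

theorem traceNorm_reampliation_le {n : ℕ} (e : J ≃ I × Fin n) {T : Module.End ℂ (Matrix I I ℂ)}
    (hT : diamondNorm T ≠ ∞) (X : Matrix J J ℂ) :
    traceNorm (reampliation e T X) ≤ (diamondNorm T).toReal * traceNorm X := by
  have h1 : oneNorm (ampliation n T) ≤ diamondNorm T := le_iSup (fun n => oneNorm (ampliation n T)) n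
  rw [reampliation, traceNorm_submatrix]
  refine (traceNorm_apply_le (ne_top_of_le_ne_top hT h1) _).trans ?_
  rw [traceNorm_submatrix]
  exact mul_le_mul_of_nonneg_right (ENNReal.toReal_mono hT h1) (traceNorm_nonneg X)

end Lindbladian

/-! ### Superoperators of regions -/

section Regions

variable {D : ℕ} {q : Site D → ℕ} {Y Z Λ : Finset (Site D)}

/-- A configuration on `Λ` is a pair of configurations on `Z` and on its complement. -/
def splitConfig (h : Z ⊆ Λ) : Config q Λ ≃ Config q Z × Config q (Λ \ Z) where
  toFun σ := (restr h σ, restr Finset.sdiff_subset σ)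
  invFun p x := if hx : (x : Site D) ∈ Z then p.1 ⟨x, hx⟩
    else p.2 ⟨x, Finset.mem_sdiff.2 ⟨x.2, hx⟩⟩
  left_inv σ := by
    ext x
    by_cases hx : (x : Site D) ∈ Z <;> simp [hx, restr]
  right_inv p := by
    refine Prod.ext (funext fun x => ?_) (funext fun x => ?_)
    · simp [restr]
    · have hx := (Finset.mem_sdiff.1 x.2).2
      simp [restr, hx]

theorem restr_glue_of_disjoint (h : Z ⊆ Λ) (hd : Disjoint Y Z) (a : Config q Y)
    (σ : Config q Λ) : restr h (glue a σ) = restr h σ := by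
  funext x
  simp [restr, glue, Finset.disjoint_right.1 hd x.2]

theorem restr_glue_comm (h : Y ⊆ Λ) (a : Config q Z) (σ : Config q Λ) :
    restr h (glue a σ) = glue a (restr h σ) := by
  funext x
  simp [restr, glue]

theorem glue_glue_of_disjoint (hd : Disjoint Y Z) (a : Config q Y) (b : Config q Z)
    (σ : Config q Λ) : glue a (glue b σ) = glue b (glue a σ) := by
  funext x
  by_cases hx : (x : Site D) ∈ Y
  · simp [glue, hx, Finset.disjoint_left.1 hd hx]
  · simp [glue, hx]

theorem splitConfig_symm (h : Z ⊆ Λ) (a : Config q Z) (σ : Config q Λ) :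
    (splitConfig h).symm (a, (splitConfig h σ).2) = glue a σ := by
  funext x
  rfl

/-- Number the configurations of Λ \ Z by `Fin n`. This brings `extend` into the form of the
ampliations in the diamond norm, so norm bounds and the Lindblad form pass to larger regions. -/
theorem exists_extend_eq_reampliation (h : Z ⊆ Λ) :
    ∃ (n : ℕ) (e : Config q Λ ≃ Config q Z × Fin n),
      ∀ (T : SuperOp q Z) (X : Op q Λ), extend h T X = reampliation e T X := by
  let f := Fintype.equivFin (Config q (Λ \ Z))
  refine ⟨_, (splitConfig h).trans (Equiv.prodCongr (Equiv.refl _) f), fun T X => ?_⟩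
  ext σ σ'
  have h1 : ∀ (a : Config q Z) (σ : Config q Λ),
      ((splitConfig h).trans (Equiv.prodCongr (Equiv.refl _) f)).symm
        (a, (((splitConfig h).trans (Equiv.prodCongr (Equiv.refl _) f)) σ).2) = glue a σ := by
    intro a σ
    rw [← splitConfig_symm h]
    simp
  simp only [reampliation, ampliation, LinearMap.coe_mk, AddHom.coe_mk, Matrix.submatrix_apply,
    Matrix.of_apply, h1]
  rfl

theorem IsLindbladian.extend (h : Z ⊆ Λ) {T : SuperOp q Z} (hT : IsLindbladian T) :
    IsLindbladian (extend h T) := by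
  obtain ⟨n, e, he⟩ := exists_extend_eq_reampliation (q := q) h
  exact hT.reampliation e (he T)

theorem traceNorm_extend_le (h : Z ⊆ Λ) {T : SuperOp q Z} (hT : diamondNorm T ≠ ∞) (X : Op q Λ) :
    traceNorm (extend h T X) ≤ (diamondNorm T).toReal * traceNorm X := by
  obtain ⟨n, e, he⟩ := exists_extend_eq_reampliation (q := q) h
  rw [he]
  exact traceNorm_reampliation_le e hT X

/-- The kernel form of T ⊗ id, which turns commutation and product identities into manipulations of
finite sums. -/
theorem extend_apply (h : Z ⊆ Λ) (T : SuperOp q Z) (X : Op q Λ) (σ σ' : Config q Λ) :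
    extend h T X σ σ' = ∑ a, ∑ a', X (glue a σ) (glue a' σ') *
      T (Matrix.single a a' 1) (restr h σ) (restr h σ') := by
  have h1 : extend h T X σ σ' = T (Matrix.of fun a a' => X (glue a σ) (glue a' σ'))
    (restr h σ) (restr h σ') := rfl
  rw [h1, Matrix.matrix_eq_sum_single (Matrix.of fun a a' => X (glue a σ) (glue a' σ'))]
  simp only [map_sum, Matrix.sum_apply]
  refine Finset.sum_congr rfl fun a _ => Finset.sum_congr rfl fun a' _ => ?_
  rw [Matrix.of_apply, ← mul_one (X _ _), ← smul_eq_mul, ← Matrix.smul_single, map_smul,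
    Matrix.smul_apply, smul_eq_mul, smul_eq_mul, mul_one]

/-- Superoperators of disjoint regions commute. -/
theorem extend_commute (hY : Y ⊆ Λ) (hZ : Z ⊆ Λ) (hd : Disjoint Y Z) (S : SuperOp q Y)
    (T : SuperOp q Z) : Commute (extend hY S) (extend hZ T) := by
  refine LinearMap.ext fun X => ?_
  ext σ σ'
  rw [Module.End.mul_apply, Module.End.mul_apply]
  simp only [extend_apply, restr_glue_of_disjoint hZ hd, restr_glue_of_disjoint hY hd.symm,
    Finset.sum_mul]
  rw [Finset.sum_congr rfl fun a _ => Finset.sum_comm, Finset.sum_comm]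
  refine Finset.sum_congr rfl fun b _ => ?_
  rw [Finset.sum_congr rfl fun a _ => Finset.sum_comm, Finset.sum_comm]
  refine Finset.sum_congr rfl fun b' _ => Finset.sum_congr rfl fun a _ =>
    Finset.sum_congr rfl fun a' _ => ?_
  rw [glue_glue_of_disjoint hd, glue_glue_of_disjoint hd, mul_right_comm]

/-- A term inside Y does not see the second factor; frustration freeness for the smaller region
thereby applies to ρ ⊗ τ. -/
theorem extend_tensor (h : Y ⊆ Λ) (hZ : Z ⊆ Y) (T : SuperOp q Z) (ρ : Op q Y)
    (τ : Op q (Λ \ Y)) :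
    OpenLattice.extend (hZ.trans h) T (tensor h ρ τ) = tensor h (OpenLattice.extend hZ T ρ) τ := by
  ext σ σ'
  have hd : Disjoint Z (Λ \ Y) := Finset.disjoint_of_subset_left hZ Finset.disjoint_sdiff
  rw [extend_apply, tensor, tensor, Matrix.of_apply, extend_apply]
  simp only [Matrix.of_apply, restr_glue_comm h, restr_glue_of_disjoint _ hd,
    Finset.sum_mul]
  exact Finset.sum_congr rfl fun a _ => Finset.sum_congr rfl fun a' _ => mul_right_comm _ _ _

open scoped Kronecker in
theorem traceNorm_tensor_le (h : Z ⊆ Λ) {ρ : Op q Z} {τ : Op q (Λ \ Z)} (hρ : IsState ρ)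
    (hτ : IsState τ) : traceNorm (tensor h ρ τ) ≤ 1 := by
  have h1 : tensor h ρ τ = (ρ ⊗ₖ τ).submatrix (splitConfig h) (splitConfig h) := rfl
  rw [h1, traceNorm_submatrix]
  refine (traceNorm_le_trace (hρ.1.kronecker hτ.1)).trans ?_
  rw [Matrix.trace_kronecker, hρ.2, hτ.2]
  simp

end Regions

/-! ### Propagation estimates for sums of local generators -/

section Propagation

open NormedSpace Filter Topology

variable {V : Type*} [DecidableEq V]

/-- Union bound: a set meeting A is counted on the right at least once. -/
theorem sum_filter_not_disjoint_le (S : Finset (Finset V)) (A : Finset V) {g : Finset V → ℝ}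
    (hg : ∀ Z, 0 ≤ g Z) :
    ∑ Z ∈ S with ¬ Disjoint Z A, g Z ≤ ∑ x ∈ A, ∑ Z ∈ S with x ∈ Z, g Z := by
  simp only [Finset.sum_filter]
  rw [Finset.sum_comm]
  refine Finset.sum_le_sum fun Z _ => ?_
  have h0 : ∀ x ∈ A, 0 ≤ if x ∈ Z then g Z else 0 := fun x _ => by
    split_ifs
    exacts [hg Z, le_rfl]
  split_ifs with h
  · exact Finset.sum_nonneg h0
  · obtain ⟨x, hxZ, hxA⟩ := Finset.not_disjoint_iff.1 h
    exact (if_pos hxZ).ge.trans (Finset.single_le_sum h0 hxA)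

variable {E : Type*} [NormedAddCommGroup E] [NormedSpace ℝ E] [CompleteSpace E]
  {S : Finset (Finset V)} {M : Finset V → E →L[ℝ] E} {L : E →L[ℝ] E} {x₀ : E}
  {a w : Finset V → ℝ} {n : V → ℝ} {n₀ v β : ℝ}

/-- One iteration of the Lieb-Robinson recursion: a bound `p` on the weighted size of the local
terms along the evolution is improved to `v (1 + ∫ p)`. -/
theorem propagation_step (hx₀ : ‖x₀‖ ≤ 1)
    (hL : ∀ t : ℝ, 0 ≤ t → ‖exp (t • L)‖ ≤ 1) (hM : ∀ Z ∈ S, Z.Nonempty → ‖M Z‖ ≤ a Z)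
    (hloc : ∀ Z ∈ S, Z.Nonempty → ∃ N R : E →L[ℝ] E,
      L = N + ∑ Z' ∈ S with ¬ Disjoint Z' Z, M Z' + R ∧ Commute (M Z) N ∧
      (∀ t : ℝ, 0 ≤ t → ‖exp (t • N)‖ ≤ 1) ∧
      ∀ x ∈ Z, n x * ‖R‖ ≤ β * w Z)
    (hn : ∀ x, 0 < n x) (hβ : 0 ≤ β)
    (hsum : ∀ x, ∑ Z ∈ S with x ∈ Z, a Z * Z.card * w Z ≤ v)
    (hnw : ∀ Z ∈ S, ∀ x ∈ Z, ∀ y ∈ Z, n x ≤ w Z * n y)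
    (hx₀M : ∀ Z ∈ S, M Z x₀ = 0 ∨ ∀ x ∈ Z, n x ≤ w Z) {p Q : ℝ → ℝ}
    (hp : ∀ x s, 0 ≤ s → n x * ∑ Z ∈ S with x ∈ Z, ‖M Z (exp (s • L) x₀)‖ + β ≤ p s)
    (hQ : ∀ s, HasDerivAt Q (p s) s) (hQ0 : ∀ s, 0 ≤ s → Q 0 ≤ Q s) (x : V) {t : ℝ}
    (ht : 0 ≤ t) :
    n x * ∑ Z ∈ S with x ∈ Z, ‖M Z (exp (t • L) x₀)‖ ≤ v * (1 + Q t - Q 0) := by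
  have hy : ∀ s : ℝ, 0 ≤ s → ‖exp (s • L) x₀‖ ≤ 1 := fun s hs =>
    ((ContinuousLinearMap.le_opNorm _ _).trans
      (mul_le_mul (hL s hs) hx₀ (norm_nonneg _) zero_le_one)).trans (one_mul (1 : ℝ)).le
  have key : ∀ Z ∈ S, x ∈ Z →
      n x * ‖M Z (exp (t • L) x₀)‖ ≤ a Z * Z.card * w Z * (1 + Q t - Q 0) := by
    intro Z hZ hxZ
    have ha : 0 ≤ a Z := (norm_nonneg _).trans (hM Z hZ ⟨x, hxZ⟩)
    have hw : 0 ≤ w Z := nonneg_of_mul_nonneg_left ((hn x).le.trans (hnw Z hZ x hxZ x hxZ)) (hn x)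
    have hc : (1 : ℝ) ≤ Z.card := by exact_mod_cast Finset.card_pos.2 ⟨x, hxZ⟩
    obtain ⟨N, R, hLN, hcomm, hN, hR⟩ := hloc Z hZ ⟨x, hxZ⟩
    -- Since M_Z commutes with N, M_Z e^{sL} x₀ evolves under N with a source made of R and the
    -- terms meeting Z.
    have h := norm_le_of_hasDerivAt hN (f := fun s => M Z (exp (s • L) x₀))
      (r := fun s => M Z (∑ Z' ∈ S with ¬ Disjoint Z' Z, M Z' (exp (s • L) x₀) +
        R (exp (s • L) x₀)))
      (Φ := fun s => (n x)⁻¹ * (a Z * Z.card * w Z * (1 + Q s - Q 0)))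
      (φ := fun s => (n x)⁻¹ * (a Z * Z.card * w Z * p s)) (fun s => ?_) (fun s => ?_)
      (fun s hs => ?_) ?_ ht
    · rw [inv_mul_eq_div, le_div_iff₀ (hn x)] at h
      rwa [mul_comm (n x)]
    · refine ((M Z).hasFDerivAt.comp_hasDerivAt s (hasDerivAt_exp_smul_apply L x₀ s)).congr_deriv ?_
      have h1 : ∀ y, M Z (N y) = N (M Z y) := fun y => DFunLike.congr_fun hcomm.eq y
      conv_lhs => rw [hLN]
      simp only [add_apply, sum_apply, map_add, h1]
      rw [← hLN]
      abel
    · exact (((hQ s).const_add 1).sub_const (Q 0)).const_mul _ |>.const_mul _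
    · rw [inv_mul_eq_div, le_div_iff₀ (hn x), mul_comm]
      have h1 : ‖∑ Z' ∈ S with ¬ Disjoint Z' Z, M Z' (exp (s • L) x₀) + R (exp (s • L) x₀)‖ ≤
          ∑ y ∈ Z, (∑ Z' ∈ S with y ∈ Z', ‖M Z' (exp (s • L) x₀)‖) + ‖R‖ := by
        refine (norm_add_le _ _).trans (add_le_add ((norm_sum_le _ _).trans
          (sum_filter_not_disjoint_le S Z fun Z' => norm_nonneg _)) ?_)
        exact (R.le_opNorm _).trans (mul_le_of_le_one_right (norm_nonneg _) (hy s hs))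
      have h2 : n x * (∑ y ∈ Z, (∑ Z' ∈ S with y ∈ Z', ‖M Z' (exp (s • L) x₀)‖) + ‖R‖) ≤
          Z.card * w Z * p s := by
        -- Moving the weight from x to y costs `w Z`. The `-β` kept at each of the |Z| sites y
        -- leaves room to absorb ‖R‖.
        have h3 : ∀ y ∈ Z, n x * (∑ Z' ∈ S with y ∈ Z', ‖M Z' (exp (s • L) x₀)‖) ≤
            w Z * (p s - β) := fun y hyZ => by
          have h4 := hp y s hs
          have h5 : 0 ≤ ∑ Z' ∈ S with y ∈ Z', ‖M Z' (exp (s • L) x₀)‖ :=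
            Finset.sum_nonneg fun _ _ => norm_nonneg _
          calc _ ≤ w Z * n y * (∑ Z' ∈ S with y ∈ Z', ‖M Z' (exp (s • L) x₀)‖) :=
                mul_le_mul_of_nonneg_right (hnw Z hZ x hxZ y hyZ) h5
            _ ≤ _ := by
                rw [mul_assoc]
                exact mul_le_mul_of_nonneg_left (by linarith) hw
        have h4 := Finset.sum_le_sum h3
        rw [← Finset.mul_sum, Finset.sum_const, nsmul_eq_mul] at h4
        have h5 := hR x hxZ
        have h6 : 0 ≤ (Z.card - 1) * (w Z * β) := by
          have := mul_nonneg hw hβ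
          nlinarith
        nlinarith
      calc _ ≤ n x * (a Z * (∑ y ∈ Z, (∑ Z' ∈ S with y ∈ Z', ‖M Z' (exp (s • L) x₀)‖) + ‖R‖)) := by
            refine mul_le_mul_of_nonneg_left (((M Z).le_opNorm _).trans ?_) (hn x).le
            exact mul_le_mul (hM Z hZ ⟨x, hxZ⟩) h1 (norm_nonneg _) ha
        _ = a Z * (n x * (∑ y ∈ Z, (∑ Z' ∈ S with y ∈ Z', ‖M Z' (exp (s • L) x₀)‖) + ‖R‖)) := by
            ring
        _ ≤ a Z * (Z.card * w Z * p s) := mul_le_mul_of_nonneg_left h2 ha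
        _ = _ := by ring
    · have h1 : exp ((0 : ℝ) • L) x₀ = x₀ := by simp
      rw [h1, add_sub_cancel_right, mul_one, inv_mul_eq_div, le_div_iff₀ (hn x)]
      -- Either the initial value vanishes, or `w Z` alone dominates the weight; the 1 in `1 + Q t -
      -- Q 0` pays for the second case.
      rcases hx₀M Z hZ with h0 | h0
      · rw [h0, norm_zero, zero_mul]
        positivity
      · calc ‖M Z x₀‖ * n x ≤ a Z * w Z := mul_le_mul (((M Z).le_opNorm _).trans
              ((mul_le_of_le_one_right (norm_nonneg _) hx₀).trans (hM Z hZ ⟨x, hxZ⟩))) (h0 x hxZ)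
              (hn x).le ha
          _ ≤ a Z * Z.card * w Z :=
              mul_le_mul_of_nonneg_right (le_mul_of_one_le_right ha hc) hw
  rw [Finset.mul_sum]
  refine (Finset.sum_le_sum fun Z hZ => key Z (Finset.mem_filter.1 hZ).1
    (Finset.mem_filter.1 hZ).2).trans ?_
  rw [← Finset.sum_mul]
  exact mul_le_mul_of_nonneg_right (hsum x) (by linarith [hQ0 t ht])

/-- A Lieb-Robinson bound: local terms that annihilate the initial vector far from the boundary
stay small there. -/
theorem propagation_bound (hx₀ : ‖x₀‖ ≤ 1)
    (hL : ∀ t : ℝ, 0 ≤ t → ‖exp (t • L)‖ ≤ 1) (hM : ∀ Z ∈ S, Z.Nonempty → ‖M Z‖ ≤ a Z)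
    (hloc : ∀ Z ∈ S, Z.Nonempty → ∃ N R : E →L[ℝ] E,
      L = N + ∑ Z' ∈ S with ¬ Disjoint Z' Z, M Z' + R ∧ Commute (M Z) N ∧
      (∀ t : ℝ, 0 ≤ t → ‖exp (t • N)‖ ≤ 1) ∧
      ∀ x ∈ Z, n x * ‖R‖ ≤ β * w Z)
    (hn : ∀ x, 0 < n x) (hβ : 0 ≤ β) (hv : 0 < v) (hn₀ : ∀ x, n x ≤ n₀)
    (hsum : ∀ x, ∑ Z ∈ S with x ∈ Z, a Z * Z.card * w Z ≤ v)
    (hnw : ∀ Z ∈ S, ∀ x ∈ Z, ∀ y ∈ Z, n x ≤ w Z * n y)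
    (hx₀M : ∀ Z ∈ S, M Z x₀ = 0 ∨ ∀ x ∈ Z, n x ≤ w Z) (x : V) {t : ℝ} (ht : 0 ≤ t) :
    n x * ∑ Z ∈ S with x ∈ Z, ‖M Z (exp (t • L) x₀)‖ ≤ (v + β) * Real.exp (v * t) := by
  -- Grönwall by iteration, which avoids any regularity of the supremum over x. The first
  -- exponential is the fixed point of the recursion; the excess with e^{2vs} is halved each time
  -- because v∫e^{2vs} ≤ e^{2vs}/2. The bound `n₀` enters only the a priori excess.
  have hind : ∀ k : ℕ, ∀ x s, 0 ≤ s → n x * ∑ Z ∈ S with x ∈ Z, ‖M Z (exp (s • L) x₀)‖ + β ≤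
      (v + β) * Real.exp (v * s) + (n₀ * v + β) * (1 / 2) ^ k * Real.exp (2 * v * s) := by
    intro k
    induction k with
    | zero =>
      intro x s hs
      have h1 : ∑ Z ∈ S with x ∈ Z, ‖M Z (exp (s • L) x₀)‖ ≤ v := by
        refine le_trans (Finset.sum_le_sum fun Z hZ => ?_) (hsum x)
        obtain ⟨hZ, hxZ⟩ := Finset.mem_filter.1 hZ
        have ha : 0 ≤ a Z := (norm_nonneg _).trans (hM Z hZ ⟨x, hxZ⟩)
        have hw : 1 ≤ w Z := le_of_mul_le_mul_right
          (by simpa using hnw Z hZ x hxZ x hxZ) (hn x)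
        have hc : (1 : ℝ) ≤ Z.card := by exact_mod_cast Finset.card_pos.2 ⟨x, hxZ⟩
        have hy : ‖exp (s • L) x₀‖ ≤ 1 := ((ContinuousLinearMap.le_opNorm _ _).trans
          (mul_le_mul (hL s hs) hx₀ (norm_nonneg _) zero_le_one)).trans (one_mul (1 : ℝ)).le
        refine ((M Z).le_opNorm _).trans ((mul_le_of_le_one_right (norm_nonneg _) hy).trans
          ((hM Z hZ ⟨x, hxZ⟩).trans ?_))
        rw [mul_assoc]
        exact le_mul_of_one_le_right ha (one_le_mul_of_one_le_of_one_le hc hw)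
      have h2 : n x * ∑ Z ∈ S with x ∈ Z, ‖M Z (exp (s • L) x₀)‖ ≤ n₀ * v :=
        mul_le_mul (hn₀ x) h1 (Finset.sum_nonneg fun _ _ => norm_nonneg _)
          ((hn x).le.trans (hn₀ x))
      have h3 : 0 ≤ n₀ * v := mul_nonneg ((hn x).le.trans (hn₀ x)) hv.le
      have h4 : 1 ≤ Real.exp (2 * v * s) := Real.one_le_exp (by positivity)
      have h5 : 0 ≤ (v + β) * Real.exp (v * s) := by positivity
      rw [pow_zero, mul_one]
      nlinarith
    | succ k ih =>
      intro x s hs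
      have hC : 0 ≤ (n₀ * v + β) * (1 / 2) ^ k := by
        have := (hn x).le.trans (hn₀ x)
        positivity
      have h := propagation_step hx₀ hL hM hloc hn hβ hsum hnw hx₀M ih
        (Q := fun s => (v + β) * (v⁻¹ * Real.exp (v * s)) +
          (n₀ * v + β) * (1 / 2) ^ k * ((2 * v)⁻¹ * Real.exp (2 * v * s))) (fun s => ?_)
        (fun s hs => ?_) x hs
      · simp only [mul_zero, Real.exp_zero, mul_one] at h
        have h1 : v * (1 + ((v + β) * (v⁻¹ * Real.exp (v * s)) +
            (n₀ * v + β) * (1 / 2) ^ k * ((2 * v)⁻¹ * Real.exp (2 * v * s))) -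
            ((v + β) * v⁻¹ + (n₀ * v + β) * (1 / 2) ^ k * (2 * v)⁻¹)) =
            (v + β) * Real.exp (v * s) + (n₀ * v + β) * (1 / 2) ^ (k + 1) * Real.exp (2 * v * s)
            - β - (n₀ * v + β) * (1 / 2) ^ k / 2 := by
          rw [pow_succ]
          field_simp
          ring
        rw [h1] at h
        linarith
      · have h1 : ∀ u : ℝ, u ≠ 0 → HasDerivAt (fun s => u⁻¹ * Real.exp (u * s))
            (Real.exp (u * s)) s := fun u hu => by
          refine ((((hasDerivAt_id s).const_mul u).exp).const_mul u⁻¹).congr_deriv ?_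
          simp only [id]
          field_simp
        exact ((h1 v hv.ne').const_mul _).add ((h1 (2 * v) (by positivity)).const_mul _)
      · have h1 : Real.exp (v * 0) ≤ Real.exp (v * s) := Real.exp_le_exp.2 (by
          rw [mul_zero]; positivity)
        have h2 : Real.exp (2 * v * 0) ≤ Real.exp (2 * v * s) := Real.exp_le_exp.2 (by
          rw [mul_zero]; positivity)
        gcongr
  have hlim : Tendsto (fun k : ℕ => (v + β) * Real.exp (v * t) +
      (n₀ * v + β) * (1 / 2) ^ k * Real.exp (2 * v * t)) atTop
      (𝓝 ((v + β) * Real.exp (v * t))) := by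
    have h1 := tendsto_pow_atTop_nhds_zero_of_lt_one (r := (1 / 2 : ℝ)) (by norm_num) (by norm_num)
    simpa using ((h1.const_mul (n₀ * v + β)).mul_const (Real.exp (2 * v * t))).const_add
      ((v + β) * Real.exp (v * t))
  linarith [ge_of_tendsto' hlim fun k => hind k x t ht]

/-- The effect of removing the local terms that touch `A`, where the initial vector is
annihilated. -/
theorem norm_exp_sub_exp_le {L' R : E →L[ℝ] E} {A : Finset V} {ρ' : ℝ} (hx₀ : ‖x₀‖ ≤ 1)
    (hL : ∀ t : ℝ, 0 ≤ t → ‖exp (t • L)‖ ≤ 1) (hL' : ∀ t : ℝ, 0 ≤ t → ‖exp (t • L')‖ ≤ 1)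
    (hLL' : L = L' + ∑ Z ∈ S with ¬ Disjoint Z A, M Z + R) (hR : ‖R‖ ≤ ρ') (hv : 0 < v)
    (hn₀ : 0 < n₀) (hbound : ∀ x ∈ A, ∀ t, 0 ≤ t →
      n₀ * ∑ Z ∈ S with x ∈ Z, ‖M Z (exp (t • L) x₀)‖ ≤ (v + β) * Real.exp (v * t))
    {t : ℝ} (ht : 0 ≤ t) :
    ‖exp (t • L) x₀ - exp (t • L') x₀‖ ≤
      A.card * (n₀⁻¹ * ((1 + β / v) * (Real.exp (v * t) - 1))) + ρ' * t := by
  refine norm_le_of_hasDerivAt hL' (f := fun s => exp (s • L) x₀ - exp (s • L') x₀)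
      (r := fun s => ∑ Z ∈ S with ¬ Disjoint Z A, M Z (exp (s • L) x₀) + R (exp (s • L) x₀))
      (Φ := fun s => A.card * (n₀⁻¹ * ((1 + β / v) * (Real.exp (v * s) - 1))) + ρ' * s)
      (φ := fun s => A.card * (n₀⁻¹ * ((v + β) * Real.exp (v * s))) + ρ') (fun s => ?_)
      (fun s => ?_) (fun s hs => ?_) ?_ ht
  · refine ((hasDerivAt_exp_smul_apply L x₀ s).sub
      (hasDerivAt_exp_smul_apply L' x₀ s)).congr_deriv ?_
    conv_lhs => enter [1]; rw [hLL']
    simp only [add_apply, sum_apply, map_sub]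
    rw [← hLL']
    abel
  · have h1 := ((((((hasDerivAt_id s).const_mul v).exp).sub_const 1).const_mul
      (1 + β / v)).const_mul n₀⁻¹).const_mul (A.card : ℝ)
    refine (h1.add ((hasDerivAt_id s).const_mul ρ')).congr_deriv ?_
    simp only [id]
    field_simp
  · refine (norm_add_le _ _).trans (add_le_add ((norm_sum_le _ _).trans
      ((sum_filter_not_disjoint_le S A fun Z => norm_nonneg _).trans ?_)) ?_)
    · rw [← nsmul_eq_mul]
      refine Finset.sum_le_card_nsmul _ _ _ fun x hx => ?_
      rw [inv_mul_eq_div, le_div_iff₀ hn₀, mul_comm]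
      exact hbound x hx s hs
    · refine (R.le_opNorm _).trans ((mul_le_of_le_one_right (norm_nonneg _) ?_).trans hR)
      exact ((ContinuousLinearMap.le_opNorm _ _).trans
        (mul_le_mul (hL s hs) hx₀ (norm_nonneg _) zero_le_one)).trans (one_mul (1 : ℝ)).le
  · simp

end Propagation

/-! ### The generators of a uniform family -/

section Generators

variable {D : ℕ} {q : Site D → ℕ}

namespace BoundaryTerms

variable {Λ : Finset (Site D)} (B : BoundaryTerms q Λ)

theorem upTo_eq_sum_range (n : ℕ) :
    B.upTo n = ∑ d ∈ Finset.range n, extend (bdry_subset (d + 1) Λ) (B.term (d + 1)) := by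
  rw [upTo, Finset.range_eq_Ico, Finset.sum_Ico_add' (fun d => extend (bdry_subset d Λ) (B.term d))]
  rfl

/-- Only pointwise convergence of the series is given, so the partial sums of the tail are bounded
first and the bound passes to the limit. -/
theorem norm_total_sub_upTo_le (n : ℕ)
    (h : ∑' d : {d : ℕ // 1 ≤ d ∧ n + 1 ≤ d}, diamondNorm (B.term d) ≠ ∞) :
    ‖superCLM (B.total - B.upTo n)‖ ≤
      (∑' d : {d : ℕ // 1 ≤ d ∧ n + 1 ≤ d}, diamondNorm (B.term d)).toReal := by
  set C := ∑' d : {d : ℕ // 1 ≤ d ∧ n + 1 ≤ d}, diamondNorm (B.term d) with hC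
  refine norm_superCLM_le ENNReal.toReal_nonneg fun X => ?_
  let g : ℕ → Op q Λ := fun d => extend (bdry_subset (d + 1) Λ) (B.term (d + 1)) X
  have hg : Summable g := B.summable X
  have h1 : (B.total - B.upTo n) X = ∑' d, g (d + n) := by
    have h2 : (B.total - B.upTo n) X = ∑' d, g d - ∑ d ∈ Finset.range n, g d := by
      rw [LinearMap.sub_apply, upTo_eq_sum_range, LinearMap.sum_apply]
      rfl
    rw [h2, ← hg.sum_add_tsum_nat_add n, add_sub_cancel_left]
  have h3 : Filter.Tendsto (fun N => toTraceClass (∑ d ∈ Finset.range N, g (d + n))) Filter.atTop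
      (nhds (toTraceClass (∑' d, g (d + n)))) :=
    (toTraceClass.toContinuousLinearEquiv.continuous.tendsto _).comp
      ((summable_nat_add_iff n).2 hg).hasSum.tendsto_sum_nat
  rw [h1, ← norm_toTraceClass]
  refine le_of_tendsto' h3.norm fun N => ?_
  let i : ℕ → {d : ℕ // 1 ≤ d ∧ n + 1 ≤ d} := fun d => ⟨d + n + 1, by omega, by omega⟩
  have hi : Function.Injective i := fun d d' hd => by
    have := congrArg Subtype.val hd
    simp only [i] at this
    omega
  have hfin : ∀ d, diamondNorm (B.term (i d)) ≠ ∞ := fun d => ENNReal.ne_top_of_tsum_ne_top h _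
  have h4 : ∑ d ∈ Finset.range N, (diamondNorm (B.term (i d))).toReal ≤ C.toReal := by
    rw [← ENNReal.toReal_sum fun d _ => hfin d]
    refine ENNReal.toReal_mono h ?_
    exact (ENNReal.sum_le_tsum _).trans
      (ENNReal.tsum_comp_le_tsum_of_injective hi fun d => diamondNorm (B.term d))
  rw [map_sum]
  refine (norm_sum_le _ _).trans ?_
  refine le_trans (Finset.sum_le_sum fun d _ => traceNorm_extend_le (bdry_subset (d + n + 1) Λ)
    (hfin d) X) ?_
  rw [← Finset.sum_mul]
  exact mul_le_mul_of_nonneg_right h4 (traceNorm_nonneg X)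

end BoundaryTerms

namespace UniformFamily

variable (F : UniformFamily q)

/-- The bulk term of `Z` as a superoperator of `Λ`, zero unless `Z ⊆ Λ`. -/
def localTerm (Λ Z : Finset (Site D)) : SuperOp q Λ :=
  if h : Z ⊆ Λ then extend h (F.M Z) else 0

variable {F} {Y Z Λ S : Finset (Site D)}

theorem localTerm_of_subset (h : Z ⊆ Λ) : F.localTerm Λ Z = extend h (F.M Z) := dif_pos h

theorem bulk_eq_sum (h : S ⊆ Λ) : F.bulk h = ∑ Z ∈ S.powerset, F.localTerm Λ Z := by
  refine Eq.trans ?_ (Finset.sum_coe_sort S.powerset (F.localTerm Λ))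
  exact Finset.sum_congr rfl fun Z _ =>
    (localTerm_of_subset ((Finset.mem_powerset.1 Z.2).trans h)).symm

theorem isLindbladian_localTerm : IsLindbladian (F.localTerm Λ Z) := by
  rw [localTerm]
  split_ifs with h
  · exact (F.isLindbladian_M Z).extend h
  · exact IsLindbladian.zero

theorem isLindbladian_closed : IsLindbladian (F.closed Λ) := by
  rw [closed, bulk_eq_sum]
  exact (IsLindbladian.sum fun _ _ => isLindbladian_localTerm).add (F.isLindbladian_B Λ)

theorem isLindbladian_removed {k : ℕ} : IsLindbladian (F.removed Λ S k) := by
  rw [removed, bulk_eq_sum]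
  exact (IsLindbladian.sum fun _ _ => isLindbladian_localTerm).add (F.isLindbladian_upTo Λ k)

theorem commute_localTerm (h : Disjoint Y Z) : Commute (F.localTerm Λ Y) (F.localTerm Λ Z) := by
  rw [localTerm, localTerm]
  split_ifs
  · exact extend_commute _ _ h _ _
  all_goals simp

theorem commute_localTerm_upTo {k : ℕ} (h : ∀ d, 1 ≤ d → d ≤ k → Disjoint Z (bdry d Λ)) :
    Commute (F.localTerm Λ Z) ((F.B Λ).upTo k) := by
  refine Commute.sum_right _ _ _ fun d hd => ?_
  rw [localTerm]
  split_ifs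
  · exact extend_commute _ _ (h d (Finset.mem_Icc.1 hd).1 (Finset.mem_Icc.1 hd).2) _ _
  · simp

theorem norm_localTerm_le (h : diamondNorm (F.M Z) ≠ ∞) :
    ‖superCLM (F.localTerm Λ Z)‖ ≤ (diamondNorm (F.M Z)).toReal := by
  refine norm_superCLM_le ENNReal.toReal_nonneg fun X => ?_
  rw [localTerm]
  split_ifs
  · exact traceNorm_extend_le _ h X
  · rw [LinearMap.zero_apply, traceNorm_zero]
    exact mul_nonneg ENNReal.toReal_nonneg (traceNorm_nonneg X)

variable {ν : ℕ → ℝ} {v b c : ℝ}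

/-- A site of Z is needed to place Z in one of the bounded sums. The empty set escapes them, but it
is disjoint from every set and so always belongs to the commuting part N. -/
theorem LiebRobinson.diamondNorm_ne_top (hF : F.LiebRobinson ν v b c) (hZ : Z.Nonempty) :
    diamondNorm (F.M Z) ≠ ∞ := by
  obtain ⟨x, hx⟩ := hZ
  intro htop
  have h1 := (ENNReal.le_tsum (f := fun Z : {Z : Finset (Site D) // x ∈ Z} =>
    diamondNorm (F.M Z) * (Z.1.card : ℝ≥0∞) * ENNReal.ofReal (ν (gdiam Z.1))) ⟨Z, hx⟩).trans
    (hF.bulk_decay x)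
  have h2 : (Z.card : ℝ≥0∞) ≠ 0 := by exact_mod_cast (Finset.card_pos.2 ⟨x, hx⟩).ne'
  have h3 : ENNReal.ofReal (ν (gdiam Z)) ≠ 0 := by simpa using hF.ν_pos (gdiam Z)
  simp only [htop] at h1
  rw [ENNReal.top_mul h2, ENNReal.top_mul h3] at h1
  exact absurd h1 (by simp)

theorem LiebRobinson.sum_le (hF : F.LiebRobinson ν v b c) (S : Finset (Finset (Site D)))
    (x : Site D) : ∑ Z ∈ S with x ∈ Z,
      (diamondNorm (F.M Z)).toReal * Z.card * ν (gdiam Z) ≤ v := by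
  let f : Finset (Site D) → ℝ≥0∞ := fun Z =>
    diamondNorm (F.M Z) * (Z.card : ℝ≥0∞) * ENNReal.ofReal (ν (gdiam Z))
  have h1 : ∑ Z ∈ S with x ∈ Z, f Z ≤ ENNReal.ofReal v := by
    rw [← Finset.sum_subtype_eq_sum_filter]
    exact (ENNReal.sum_le_tsum _).trans (hF.bulk_decay x)
  have h2 : ∀ Z ∈ S.filter fun Z => x ∈ Z, f Z ≠ ∞ := fun Z hZ =>
    ENNReal.mul_ne_top (ENNReal.mul_ne_top
      (hF.diamondNorm_ne_top ⟨x, (Finset.mem_filter.1 hZ).2⟩) (by simp)) ENNReal.ofReal_ne_top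
  have h3 := ENNReal.toReal_mono ENNReal.ofReal_ne_top h1
  rw [ENNReal.toReal_sum h2, ENNReal.toReal_ofReal hF.v_pos.le] at h3
  refine le_trans (le_of_eq (Finset.sum_congr rfl fun Z _ => ?_)) h3
  simp only [f, ENNReal.toReal_mul, ENNReal.toReal_natCast,
    ENNReal.toReal_ofReal (hF.ν_pos _).le]

theorem BoundaryDecay.norm_total_sub_upTo_le {A : Finset (Site D)}
    (hν : ∀ r, 0 < ν r) (hc : 0 < c) (h : F.BoundaryDecay ν b c A) {N : ℕ} (hN : 1 ≤ N) (n : ℕ) :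
    ν (n + 1) * ‖superCLM ((F.B (nbhd A N)).total - (F.B (nbhd A N)).upTo n)‖ ≤
      c * (N : ℝ) ^ b := by
  have h1 := h N hN (n + 1)
  have hβ : 0 ≤ c * (N : ℝ) ^ b := by positivity
  have h2 : ∑' d : {d : ℕ // 1 ≤ d ∧ n + 1 ≤ d}, diamondNorm ((F.B (nbhd A N)).term d) ≠ ∞ := by
    intro htop
    rw [htop, ENNReal.mul_top (by simpa using hν (n + 1))] at h1
    exact absurd h1 (by simp)
  have h3 := ENNReal.toReal_mono ENNReal.ofReal_ne_top h1
  rw [ENNReal.toReal_mul, ENNReal.toReal_ofReal (hν _).le, ENNReal.toReal_ofReal hβ] at h3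
  exact (mul_le_mul_of_nonneg_left ((F.B (nbhd A N)).norm_total_sub_upTo_le n h2)
    (hν _).le).trans h3

/-- The closed boundary generator splits around a finite set `Y`. -/
theorem superCLM_closed (Y : Finset (Site D)) (k : ℕ) :
    superCLM (F.closed Λ) =
      superCLM (∑ Z ∈ Λ.powerset with Disjoint Z Y, F.localTerm Λ Z + (F.B Λ).upTo k) +
      ∑ Z ∈ Λ.powerset with ¬ Disjoint Z Y, superCLM (F.localTerm Λ Z) +
      superCLM ((F.B Λ).total - (F.B Λ).upTo k) := by
  rw [closed, bulk_eq_sum, ← map_sum, ← map_add, ← map_add,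
    ← Finset.sum_filter_add_sum_filter_not Λ.powerset (fun Z => Disjoint Z Y)]
  congr 1
  abel

/-- Identifies the cut generator with the first part of the splitting `superCLM_closed` around Y. -/
theorem removed_eq_sum {k : ℕ} :
    F.removed Λ Y k = ∑ Z ∈ Λ.powerset with Disjoint Z Y, F.localTerm Λ Z + (F.B Λ).upTo k := by
  rw [removed, bulk_eq_sum]
  congr 2
  ext Z
  simp [Finset.subset_sdiff]

end UniformFamily

/-! ### The depth of a site -/

theorem gdist_le_gdiam {Z : Finset (Site D)} {x y : Site D} (hx : x ∈ Z) (hy : y ∈ Z) :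
    gdist x y ≤ gdiam Z :=
  (Finset.le_sup (f := fun y => gdist x y) hy).trans
    (Finset.le_sup (f := fun x => Z.sup fun y => gdist x y) hx)

/-- The depth `m - dist(x, A)` of a site inside the neighbourhood `A(m)`, zero outside. -/
def depth (A : Finset (Site D)) (m : ℕ) (x : Site D) : ℕ := A.sup fun y => m - gdist y x

variable {A : Finset (Site D)} {m : ℕ}

theorem depth_le (x : Site D) : depth A m x ≤ m := Finset.sup_le fun _ _ => Nat.sub_le _ _

theorem depth_of_mem {x : Site D} (hx : x ∈ A) : depth A m x = m := by
  refine le_antisymm (depth_le x) ?_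
  have h0 : m ≤ m - gdist x x := by simp [gdist]
  exact h0.trans (Finset.le_sup (f := fun y => m - gdist y x) hx)

theorem depth_le_gdist_add (x y : Site D) : depth A m x ≤ gdist x y + depth A m y := by
  refine Finset.sup_le fun z hz => ?_
  have h1 : m - gdist z y ≤ depth A m y := Finset.le_sup (f := fun z => m - gdist z y) hz
  have h2 := gdist_triangle z x y
  omega

theorem depth_eq_zero {x : Site D} (hx : x ∉ nbhd A m) : depth A m x = 0 := by
  refine Nat.eq_zero_of_le_zero (Finset.sup_le fun z hz => ?_)
  have : ¬ gdist z x ≤ m := fun h => hx (mem_nbhd.2 ⟨z, hz, h⟩)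
  omega

/-- A site of ∂_d A(m+1) is farther than m + 1 - d from A. So boundary terms with d at most the
depth of every site of Z are disjoint from Z. -/
theorem depth_lt_of_mem_bdry {d : ℕ} (hd : 1 ≤ d) {x : Site D}
    (hx : x ∈ bdry d (nbhd A (m + 1))) : depth A m x < d := by
  classical
  obtain ⟨-, y, hy, hxy⟩ := Finset.mem_filter.1 hx
  have : depth A m x ≤ d - 1 := Finset.sup_le fun z hz => by
    have h1 : ¬ gdist z y ≤ m + 1 := fun h => hy (mem_nbhd.2 ⟨z, hz, h⟩)
    have h2 := gdist_triangle z x y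
    omega
  omega

end Generators

/-! ### The main estimate -/

/-- Applies the abstract propagation estimates with site weight ν(depth x), set weight ν(diam Z) and
β = c(m+1)^b, the boundary constant of A(m+1). -/
theorem UniformFamily.traceNorm_evolve_closed_sub_evolve_removed_le {D : ℕ} {A : Finset (Site D)}
    {v b c : ℝ} {q : Site D → ℕ} {F : UniformFamily q} {ν : ℕ → ℝ} (hFF : F.FrustrationFree)
    (hF : F.LiebRobinson ν v b c) (hA : F.BoundaryDecay ν b c A) {m : ℕ} {Λ₀ Λ : Finset (Site D)}
    (h : Λ₀ ⊆ Λ) (hΛ₀ : Λ₀ = nbhd A m) (hΛ : Λ = nbhd A (m + 1)) {ρ : Op q Λ₀} {τ : Op q (Λ \ Λ₀)}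
    (hρ : F.IsFixedPoint Λ₀ ρ) (hτ : IsState τ) {t : ℝ} (ht : 0 ≤ t) :
    traceNorm (evolve (F.closed Λ) t (tensor h ρ τ) -
        evolve (F.removed Λ A (m + 1)) t (tensor h ρ τ)) ≤
      A.card * ((ν m)⁻¹ * ((1 + c * ((m + 1 : ℕ) : ℝ) ^ b / v) * (Real.exp (v * t) - 1))) +
        c * ((m + 1 : ℕ) : ℝ) ^ b * (ν m)⁻¹ * t := by
  set β := c * ((m + 1 : ℕ) : ℝ) ^ b with hβ
  set X := tensor h ρ τ with hX
  have hc := hF.c_pos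
  have hβ0 : 0 ≤ β := by positivity
  have hX1 : ‖toTraceClass X‖ ≤ 1 := traceNorm_tensor_le _ hρ.1 hτ
  have hL : ∀ t : ℝ, 0 ≤ t → ‖NormedSpace.exp (t • superCLM (F.closed Λ))‖ ≤ 1 :=
    fun _ => isLindbladian_closed.norm_exp_le_one
  -- The tail after k starts at d = k + 1, so decay gives ν(k+1); the weaker ν(k) is all that is
  -- needed.
  have htail : ∀ k, ν k * ‖superCLM ((F.B Λ).total - (F.B Λ).upTo k)‖ ≤ β := fun k => by
    rw [hΛ]
    exact (mul_le_mul_of_nonneg_right (hF.ν_mono (Nat.le_succ k)) (norm_nonneg _)).trans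
      (hA.norm_total_sub_upTo_le hF.ν_pos hc (Nat.succ_pos m) k)
  have hnw : ∀ Z ∈ Λ.powerset, ∀ x ∈ Z, ∀ y ∈ Z,
      ν (depth A m x) ≤ ν (gdiam Z) * ν (depth A m y) := fun Z _ x hx y hy =>
    (hF.ν_mono ((depth_le_gdist_add x y).trans (Nat.add_le_add_right (gdist_le_gdiam hx hy) _))).trans
      (hF.ν_mul _ _)
  have hbound : ∀ x (t : ℝ), 0 ≤ t → ν (depth A m x) * ∑ Z ∈ Λ.powerset with x ∈ Z,
      ‖superCLM (F.localTerm Λ Z) (NormedSpace.exp (t • superCLM (F.closed Λ)) (toTraceClass X))‖ ≤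
      (v + β) * Real.exp (v * t) := by
    intro x t ht
    refine propagation_bound (a := fun Z => (diamondNorm (F.M Z)).toReal)
      (w := fun Z => ν (gdiam Z)) (n := fun x => ν (depth A m x)) (n₀ := ν m) hX1 hL
      (fun Z _ hZ => norm_localTerm_le (hF.diamondNorm_ne_top hZ)) (fun Z hZΛ hZ => ?_)
      (fun x => hF.ν_pos _) hβ0 hF.v_pos (fun x => hF.ν_mono (depth_le x)) (hF.sum_le _) hnw
      (fun Z hZ => ?_) x ht
    -- Truncate the boundary condition at the depth of the shallowest site z of Z: the kept terms
    -- miss Z, and the tail is small relative to the weight at z, hence, up to ν(diam Z), at every x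
    -- in Z.
    · obtain ⟨z, hz, hzmin⟩ := Z.exists_min_image (depth A m) hZ
      refine ⟨_, _, superCLM_closed Z (depth A m z), ?_, fun s hs => ?_, fun x hx => ?_⟩
      · have h1 : Commute (F.localTerm Λ Z) (∑ Z' ∈ Λ.powerset with Disjoint Z' Z,
            F.localTerm Λ Z' + (F.B Λ).upTo (depth A m z)) := by
          refine (Commute.sum_right _ _ _ fun Z' hZ' =>
            commute_localTerm (Finset.mem_filter.1 hZ').2.symm).add_right
            (commute_localTerm_upTo fun d hd hdz => Finset.disjoint_left.2 fun x hx hxd => ?_)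
          exact absurd (depth_lt_of_mem_bdry hd (hΛ ▸ hxd)) (not_lt.2 (hdz.trans (hzmin x hx)))
        exact congrArg superCLM h1.eq
      · exact ((IsLindbladian.sum fun _ _ => isLindbladian_localTerm).add
          (F.isLindbladian_upTo Λ _)).norm_exp_le_one hs
      · calc _ ≤ ν (gdiam Z) * ν (depth A m z) * _ :=
              mul_le_mul_of_nonneg_right (hnw Z hZΛ x hx z hz) (norm_nonneg _)
          _ = ν (gdiam Z) * (ν (depth A m z) * _) := mul_assoc _ _ _
          _ ≤ ν (gdiam Z) * β := mul_le_mul_of_nonneg_left (htail _) (hF.ν_pos _).le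
          _ = _ := mul_comm _ _
    · by_cases hZ₀ : Z ⊆ Λ₀
      · left
        rw [superCLM_apply, localTerm_of_subset (hZ₀.trans h), hX,
          extend_tensor h hZ₀, hFF _ ρ hρ Z hZ₀]
        have h0 : tensor h 0 τ = 0 := by
          ext σ σ'
          simp [tensor]
        rw [h0, map_zero]
      · right
        intro x hx
        -- A set leaving A(m) contains a site of depth zero, so its diameter is at least the depth
        -- of each of its sites.
        obtain ⟨y, hy, hyA⟩ := Finset.not_subset.1 hZ₀
        refine hF.ν_mono ((depth_le_gdist_add x y).trans ?_)
        rw [depth_eq_zero (hΛ₀ ▸ hyA), add_zero]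
        exact gdist_le_gdiam hx hy
  rw [← norm_toTraceClass, map_sub, toTraceClass_evolve, toTraceClass_evolve]
  refine norm_exp_sub_exp_le (S := Λ.powerset) (M := fun Z => superCLM (F.localTerm Λ Z))
    (R := superCLM ((F.B Λ).total - (F.B Λ).upTo (m + 1))) hX1 hL
    (fun _ => isLindbladian_removed.norm_exp_le_one) ?_ ?_ hF.v_pos (hF.ν_pos m)
    (fun x hx s hs => ?_) ht
  · rw [removed_eq_sum]
    exact superCLM_closed A (m + 1)
  · rw [← div_eq_mul_inv, le_div_iff₀ (hF.ν_pos m), mul_comm]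
    exact (mul_le_mul_of_nonneg_right (hF.ν_mono (Nat.le_succ m)) (norm_nonneg _)).trans
      (htail (m + 1))
  · have := hbound x s hs
    rwa [depth_of_mem hx] at this

end OpenLattice

end

/-! ### The polynomial prefactor -/

open OpenLattice
theorem mainTheorem6 {D : ℕ} (A : Finset (Site D)) (v b c : ℝ) :
    ∃ P : Polynomial ℝ,
      ∀ (q : Site D → ℕ) (F : UniformFamily q) (ν : ℕ → ℝ),
        F.FrustrationFree → F.LiebRobinson ν v b c → F.BoundaryDecay ν b c A →
        ∀ m : ℕ, 1 ≤ m →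
        ∀ (ρ : Op q (nbhd A m)) (τ : Op q (nbhd A (m + 1) \ nbhd A m)),
          F.IsFixedPoint (nbhd A m) ρ → IsState τ →
          ∀ t : ℝ, 0 ≤ t →
            traceNorm
                (evolve (F.closed (nbhd A (m + 1))) t
                    (tensor (nbhd_mono A (Nat.le_succ m)) ρ τ) -
                  evolve (F.removed (nbhd A (m + 1)) A (m + 1)) t
                    (tensor (nbhd_mono A (Nat.le_succ m)) ρ τ)) ≤
              P.eval (m : ℝ) * (ν m)⁻¹ * (Real.exp (v * t) - 1 + t) := by
  -- Q dominates β = c(m+1)^b, with the real exponent rounded up. The final polynomial is |A|(1 +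
  -- Q/v) + Q.
  let Q : Polynomial ℝ := Polynomial.C c * (Polynomial.X + 1) ^ ⌈b⌉₊
  refine ⟨Polynomial.C (A.card : ℝ) * (1 + Polynomial.C v⁻¹ * Q) + Q, ?_⟩
  intro q F ν hFF hF hA m _ ρ τ hρ hτ t ht
  refine (UniformFamily.traceNorm_evolve_closed_sub_evolve_removed_le hFF hF hA _ rfl rfl
    hρ hτ ht).trans ?_
  have hv := hF.v_pos
  have hc := hF.c_pos
  have hν : 0 < (ν m)⁻¹ := inv_pos.2 (hF.ν_pos m)
  set β := c * ((m + 1 : ℕ) : ℝ) ^ b with hβ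
  have hQ : Q.eval (m : ℝ) = c * ((m : ℝ) + 1) ^ ⌈b⌉₊ := by simp [Q]
  have hβQ : β ≤ Q.eval (m : ℝ) := by
    rw [hQ, hβ, ← Real.rpow_natCast]
    push_cast
    exact mul_le_mul_of_nonneg_left (Real.rpow_le_rpow_of_exponent_le (by simp) (Nat.le_ceil b))
      hc.le
  have hβ0 : 0 ≤ β := by positivity
  have he : 0 ≤ Real.exp (v * t) - 1 := sub_nonneg.2 (Real.one_le_exp (by positivity))
  simp only [Polynomial.eval_add, Polynomial.eval_mul, Polynomial.eval_C, Polynomial.eval_one]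
  have h1 : 1 + β / v ≤ 1 + v⁻¹ * Q.eval (m : ℝ) := by
    rw [div_eq_inv_mul]
    gcongr
  set κ := Q.eval (m : ℝ)
  have hκ : 0 ≤ κ := hβ0.trans hβQ
  have h2 : 0 ≤ 1 + v⁻¹ * κ := by positivity
  calc _ ≤ A.card * ((ν m)⁻¹ * ((1 + v⁻¹ * κ) * (Real.exp (v * t) - 1))) + κ * (ν m)⁻¹ * t := by
        gcongr
    -- Both e^{vt} - 1 and t are at most their sum, which gives a common time factor.
    _ ≤ A.card * ((ν m)⁻¹ * ((1 + v⁻¹ * κ) * (Real.exp (v * t) - 1 + t))) +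
        κ * (ν m)⁻¹ * (Real.exp (v * t) - 1 + t) := by
        gcongr <;> linarith
    _ = _ := by ring
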